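/- Let $\mathbb D=\{z\in\mathbb C:|z|<1\}$. A radial weight is (the radial extension $\mu(z)=\mu(|z|)$ to $\mathbb D$ of) a nonnegative function $\mu\in L^1([0,1))$ such that $\widehat\mu(r)=\int_r^1\mu(s)\,ds>0$ for all $0\le r<1$. Let $\mathcal D$ be the class of radial weights $\mu$ for which there are constants $C_1>1$, $k>1$ and $C_2>1$ such that $$\widehat\mu(r)\le C_1\,\widehat\mu\Big(\frac{1+r}2\Big)\quad\text{and}\quad \widehat\mu(r)\ge C_2\,\widehat\mu\Big(1-\frac{1-r}{k}\Big)\qquad\text{for all }0\le r<1 .$$ Put $\mu_x=\int_0^1 s^x\mu(s)\,ds$ for $x\ge 0$. For an analytic function $f(z)=\sum_{n=0}^\infty\widehat f(n)z^n$ in $\mathbb D$, let $$D^\mu f(z)=\sum_{n=0}^\infty\frac{\widehat f(n)}{\mu_{2n+1}}\,z^n,\qquad z\in\mathbb D,$$ and for $0<p<\infty$, $0\le r<1$ and $g$ analytic in $\mathbb D$ let $M_p(r,g)=\Big(\frac1{2\pi}\int_0^{2\pi}|g(re^{it})|^p\,dt\Big)^{1/p}$. **Proposition.** Let $0<p<\infty$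 and $\mu\in\mathcal D$. For every analytic $f$ in $\mathbb D$ the series defining $D^\mu f$ converges (unconditionally) at every point of $\mathbb D$ and $D^\mu f$ is analytic in $\mathbb D$. Moreover, there is a constant $C=C(p,\mu)>0$ such that $$M_p(r,D^\mu f)\le C\,\frac{M_p(\rho,f)}{\widehat\mu\left(\frac r\rho\right)}$$ for all $0\le r<\rho<1$ and all analytic functions $f$ in $\mathbb D$. -/

import Mathlib

namespace FracDeriv

noncomputable section

/-- The tail `ω̂(r) = ∫_r^1 ω(s) ds`, `0 ≤ r < 1`. -/
def tail (ω : ℝ → ℝ) (r : ℝ) : ℝ := ∫ s in Set.Ico r 1, ω s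

/-- The moment `ω_x = ∫_0^1 r^x ω(r) dr`, `x ≥ 0`. -/
def moment (ω : ℝ → ℝ) (x : ℝ) : ℝ := ∫ r in Set.Ico (0 : ℝ) 1, r ^ x * ω r

/-- A radial weight on the unit disc, given by its profile `ω` on `[0,1)`: a nonnegative
integrable function on `[0,1)`, all of whose tails are positive.  Values of `ω` outside `[0,1)`
are irrelevant. -/
structure IsRadialWeight (ω : ℝ → ℝ) : Prop where
  nonneg : ∀ s ∈ Set.Ico (0 : ℝ) 1, 0 ≤ ω s
  integrableOn : MeasureTheory.IntegrableOn ω (Set.Ico (0 : ℝ) 1)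
  tail_pos : ∀ r ∈ Set.Ico (0 : ℝ) 1, 0 < tail ω r

/-- The class of (upper) doubling radial weights. -/
def IsDHat (ω : ℝ → ℝ) : Prop :=
  IsRadialWeight ω ∧
    ∃ C : ℝ, 1 < C ∧ ∀ r ∈ Set.Ico (0 : ℝ) 1, tail ω r ≤ C * tail ω ((1 + r) / 2)

/-- The class of reverse doubling radial weights. -/
def IsDCheck (ω : ℝ → ℝ) : Prop :=
  IsRadialWeight ω ∧
    ∃ k : ℝ, 1 < k ∧ ∃ C : ℝ, 1 < C ∧
      ∀ r ∈ Set.Ico (0 : ℝ) 1, C * tail ω (1 - (1 - r) / k) ≤ tail ω r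

/-- The class `𝒟` of two-sided doubling radial weights. -/
def IsD (ω : ℝ → ℝ) : Prop := IsDHat ω ∧ IsDCheck ω

/-- The `n`-th Taylor coefficient of `f` at the origin. -/
def taylorCoeff (f : ℂ → ℂ) (n : ℕ) : ℂ := iteratedDeriv n f 0 / (n.factorial : ℂ)

/-- The `n`-th term of the power series of `D^μ f`. -/
def fracDerivTerm (μ : ℝ → ℝ) (f : ℂ → ℂ) (z : ℂ) (n : ℕ) : ℂ :=
  taylorCoeff f n / ((moment μ (2 * (n : ℝ) + 1) : ℝ) : ℂ) * z ^ n

/-- The fractional derivative `D^μ f (z) = ∑ f̂(n) / μ_{2n+1} z^n` induced by `μ`. -/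
def fracDeriv (μ : ℝ → ℝ) (f : ℂ → ℂ) (z : ℂ) : ℂ := ∑' n : ℕ, fracDerivTerm μ f z n

/-- The integral mean `M_p(r, f) = ((1/2π) ∫_0^{2π} |f(r e^{it})|^p dt)^{1/p}`. -/
def integralMean (p r : ℝ) (f : ℂ → ℂ) : ℝ :=
  (Real.circleAverage (fun z => ‖f z‖ ^ p) 0 r) ^ (1 / p)

end

end FracDeriv

namespace FracDeriv

open MeasureTheory Set Metric

/-! With F(z) = f(ρz) and t = r/ρ, it suffices to compare the mean of D^μ F on the circle of radius
t with the mean of F on the unit circle. Minkowski's inequality is not available for p < 1, so the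
core is a pointwise bound valid for all p (`IsD.norm_tsum_inv_moment_le`): |D^μ F(tw)|^p is at most
a constant times tail(t)^(-p) times the average of |F(η)|^p against (1-t)^ε / (1-t+|η-w|)^(1+ε).
This kernel has mass bounded independently of t, so averaging over w and Fubini finish the proof.

For the pointwise bound, the coefficients are first multiplied by (n+1)...(n+M) with M = m+2, m ≥
2/p. Upper doubling makes each difference of 1/μ_{2n+1} gain a factor 1/(n+1), so M summations by
parts bound the resulting kernel at x by C / ((1-|x|) tail(|x|) |1-x|^M) (`IsDHat.kernel_bound`).
The modified series at s²w is a circular convolution of F(sz) with this kernel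
(`hasSum_convolution`). The value |F(sz)|^p is at most a Poisson integral (`norm_rpow_le_poisson`),
and moving that Poisson kernel to centre w and scale 1-t costs (|z-sw|/(1-s))² (`poissonKernel_le`),
which the decay of the kernel in |1-x| pays for.

The factor (n+1)...(n+M) is undone by integrating against (1-x)^(m+1). The sizes are critical:
(1-x)^(m+1)/(1-tx)^(m+2) alone would leave a logarithm. Reverse doubling supplies an additional
((1-t)/(1-tx))^κ, which makes the integral bounded uniformly in t. -/

/-! ### Tails under the two doubling conditions -/

lemma tail_integrand_nonneg {μ : ℝ → ℝ} (hμ : IsRadialWeight μ) {r : ℝ} (hr : 0 ≤ r) :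
    0 ≤ᵐ[volume.restrict (Ico r 1)] μ :=
  (ae_restrict_iff' measurableSet_Ico).2 <| .of_forall fun s hs => hμ.nonneg s ⟨hr.trans hs.1, hs.2⟩

lemma tail_anti {μ : ℝ → ℝ} (hμ : IsRadialWeight μ) {r t : ℝ} (hr : 0 ≤ r) (hrt : r ≤ t) :
    tail μ t ≤ tail μ r :=
  setIntegral_mono_set (hμ.integrableOn.mono_set (Ico_subset_Ico_left hr))
    (tail_integrand_nonneg hμ hr) (Ico_subset_Ico_left hrt).eventuallyLE

lemma tail_le_pow_mul_tail {μ : ℝ → ℝ} {C : ℝ} (hC : 1 < C)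
    (h : ∀ r ∈ Ico (0 : ℝ) 1, tail μ r ≤ C * tail μ ((1 + r) / 2)) {r : ℝ}
    (hr : r ∈ Ico (0 : ℝ) 1) (m : ℕ) : tail μ r ≤ C ^ m * tail μ (1 - (1 - r) / 2 ^ m) := by
  induction m with
  | zero => simp
  | succ m ih =>
    have h2 : (1 : ℝ) ≤ 2 ^ m := one_le_pow₀ one_le_two
    have h3 : (1 - r) / 2 ^ m ≤ 1 - r := div_le_self (by linarith [hr.2]) h2
    have h4 : 0 < (1 - r) / 2 ^ m := div_pos (by linarith [hr.2]) (by positivity)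
    have := h (1 - (1 - r) / 2 ^ m) ⟨by linarith [hr.1], by linarith⟩
    have e : (1 + (1 - (1 - r) / 2 ^ m)) / 2 = 1 - (1 - r) / 2 ^ (m + 1) := by
      rw [pow_succ]; field_simp; ring
    rw [e] at this
    calc _ ≤ _ := ih
      _ ≤ C ^ m * (C * tail μ (1 - (1 - r) / 2 ^ (m + 1))) := by gcongr
      _ = _ := by ring

/-- Iterating reverse doubling m times, with k^m comparable to (1-r)/(1-t), makes the tail drop by
C^m, a power of that ratio with exponent log C / log k. -/
lemma IsDCheck.tail_mul_rpow_le {μ : ℝ → ℝ} (hμ : IsDCheck μ) :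
    ∃ C β : ℝ, 0 < C ∧ 0 < β ∧ ∀ r t : ℝ, 0 ≤ r → r ≤ t → t < 1 →
      tail μ t * ((1 - r) / (1 - t)) ^ β ≤ C * tail μ r := by
  obtain ⟨hw, k, hk, C, hC, h⟩ := hμ
  have hlk := Real.log_pos hk
  have hlC := Real.log_pos hC
  refine ⟨C, Real.log C / Real.log k, by linarith, by positivity, fun r t hr hrt ht => ?_⟩
  have iter (m : ℕ) : C ^ m * tail μ (1 - (1 - r) / k ^ m) ≤ tail μ r := by
    induction m with
    | zero => simp
    | succ m ih =>
      have h2 : (1 : ℝ) ≤ k ^ m := one_le_pow₀ hk.le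
      have h3 : (1 - r) / k ^ m ≤ 1 - r := div_le_self (by linarith) h2
      have h4 : 0 < (1 - r) / k ^ m := div_pos (by linarith) (by positivity)
      have := h (1 - (1 - r) / k ^ m) ⟨by linarith, by linarith⟩
      have e : 1 - (1 - (1 - (1 - r) / k ^ m)) / k = 1 - (1 - r) / k ^ (m + 1) := by
        rw [pow_succ]; field_simp; ring
      rw [e] at this
      calc _ = C ^ m * (C * tail μ (1 - (1 - r) / k ^ (m + 1))) := by ring
        _ ≤ C ^ m * tail μ (1 - (1 - r) / k ^ m) := by gcongr
        _ ≤ _ := ih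
  have hq : 1 ≤ (1 - r) / (1 - t) := by rw [le_div_iff₀ (by linarith)]; linarith
  obtain ⟨m, hm1, hm2⟩ := exists_nat_pow_near hq hk
  have hkm : 0 < k ^ m := by positivity
  have htm : tail μ t ≤ tail μ (1 - (1 - r) / k ^ m) := by
    apply tail_anti hw
    · have : (1 - r) / k ^ m ≤ 1 - r := div_le_self (by linarith) (one_le_pow₀ hk.le)
      linarith
    · rw [le_div_iff₀ (by linarith)] at hm1
      have : 1 - t ≤ (1 - r) / k ^ m := by rw [le_div_iff₀ hkm]; linarith
      linarith
  have hpow : ((1 - r) / (1 - t)) ^ (Real.log C / Real.log k) ≤ C ^ (m + 1) := by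
    calc _ ≤ (k ^ (m + 1)) ^ (Real.log C / Real.log k) := by gcongr
      _ = (k ^ (Real.log C / Real.log k)) ^ (m + 1) := by
        rw [← Real.rpow_natCast, ← Real.rpow_natCast, ← Real.rpow_mul (by linarith),
          ← Real.rpow_mul (by linarith), mul_comm]
      _ = C ^ (m + 1) := by
        rw [Real.rpow_def_of_pos (by linarith), mul_div_cancel₀ _ hlk.ne', Real.exp_log (by linarith)]
  have htpos : 0 ≤ tail μ t := (hw.tail_pos t ⟨by linarith, ht⟩).le
  calc _ ≤ tail μ t * C ^ (m + 1) := by gcongr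
    _ = C * (C ^ m * tail μ t) := by ring
    _ ≤ C * (C ^ m * tail μ (1 - (1 - r) / k ^ m)) := by gcongr
    _ ≤ _ := by gcongr; exact iter m

/-! ### Moments and their differences -/

/-- The moments of `μ` against `s ^ (2 n + 1) (1 - s ^ 2) ^ j`; up to sign, these are the `j`-th
differences of the sequence of odd moments of `μ`. -/
noncomputable def diffMoment (μ : ℝ → ℝ) (j n : ℕ) : ℝ :=
  ∫ s in Ico (0 : ℝ) 1, s ^ (2 * n + 1) * (1 - s ^ 2) ^ j * μ s

lemma moment_odd (μ : ℝ → ℝ) (n : ℕ) : moment μ (2 * (n : ℝ) + 1) = diffMoment μ 0 n := by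
  unfold moment diffMoment
  refine integral_congr_ae (.of_forall fun s => ?_)
  have : (2 * (n : ℝ) + 1) = ((2 * n + 1 : ℕ) : ℝ) := by push_cast; ring
  simp only [this, Real.rpow_natCast]
  simp

lemma integrableOn_mul_weight {μ : ℝ → ℝ} (hμ : IsRadialWeight μ) {g : ℝ → ℝ}
    (hg : Continuous g) : IntegrableOn (fun s => g s * μ s) (Ico (0 : ℝ) 1) := by
  obtain ⟨C, hC⟩ := isCompact_Icc.exists_bound_of_continuousOn (s := Icc (0 : ℝ) 1) hg.continuousOn
  exact hμ.integrableOn.bdd_mul (c := C) hg.aestronglyMeasurable <|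
    (ae_restrict_iff' measurableSet_Ico).2 <| .of_forall fun s hs => hC s (Ico_subset_Icc_self hs)

lemma integral_mul_weight_mono {μ : ℝ → ℝ} (hμ : IsRadialWeight μ) {g h : ℝ → ℝ}
    (hg : Continuous g) (hh : Continuous h) (hgh : ∀ s ∈ Ico (0 : ℝ) 1, g s ≤ h s) :
    ∫ s in Ico (0 : ℝ) 1, g s * μ s ≤ ∫ s in Ico (0 : ℝ) 1, h s * μ s :=
  setIntegral_mono_on (integrableOn_mul_weight hμ hg) (integrableOn_mul_weight hμ hh)
    measurableSet_Ico fun s hs => mul_le_mul_of_nonneg_right (hgh s hs) (hμ.nonneg s hs)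

lemma diffMoment_succ {μ : ℝ → ℝ} (hμ : IsRadialWeight μ) (j n : ℕ) :
    diffMoment μ (j + 1) n = diffMoment μ j n - diffMoment μ j (n + 1) := by
  unfold diffMoment
  rw [← integral_sub (integrableOn_mul_weight hμ (by fun_prop))
    (integrableOn_mul_weight hμ (by fun_prop))]
  congr 1; ext s; ring

lemma diffMoment_anti {μ : ℝ → ℝ} (hμ : IsRadialWeight μ) (j : ℕ) {m n : ℕ} (h : m ≤ n) :
    diffMoment μ j n ≤ diffMoment μ j m := by
  refine integral_mul_weight_mono hμ (by fun_prop) (by fun_prop) fun s hs => ?_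
  have : 0 ≤ 1 - s ^ 2 := by nlinarith [hs.1, hs.2]
  exact mul_le_mul_of_nonneg_right (pow_le_pow_of_le_one hs.1 hs.2.le (by omega)) (by positivity)

lemma diffMoment_nonneg {μ : ℝ → ℝ} (hμ : IsRadialWeight μ) (j n : ℕ) : 0 ≤ diffMoment μ j n := by
  refine setIntegral_nonneg measurableSet_Ico fun s hs => ?_
  have : 0 ≤ 1 - s ^ 2 := by nlinarith [hs.1, hs.2]
  have := hs.1
  have := hμ.nonneg s hs
  positivity

lemma pow_mul_tail_le {μ : ℝ → ℝ} (hμ : IsRadialWeight μ) {r : ℝ} (hr : 0 ≤ r) (n : ℕ) :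
    r ^ (2 * n + 1) * tail μ r ≤ diffMoment μ 0 n := by
  unfold diffMoment tail
  rw [← integral_const_mul]
  have hsub : Ico r 1 ⊆ Ico (0 : ℝ) 1 := Ico_subset_Ico_left hr
  have hi := integrableOn_mul_weight hμ (g := fun s => s ^ (2 * n + 1) * (1 - s ^ 2) ^ 0)
    (by fun_prop)
  calc _ ≤ ∫ s in Ico r 1, s ^ (2 * n + 1) * (1 - s ^ 2) ^ 0 * μ s := by
        refine setIntegral_mono_on ((hμ.integrableOn.mono_set hsub).const_mul _) (hi.mono_set hsub)
          measurableSet_Ico fun s hs => ?_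
        rw [pow_zero, mul_one]
        exact mul_le_mul_of_nonneg_right (pow_le_pow_left₀ hr hs.1 _) (hμ.nonneg s (hsub hs))
    _ ≤ _ := by
        refine setIntegral_mono_set hi ?_ hsub.eventuallyLE
        refine (ae_restrict_iff' measurableSet_Ico).2 <| .of_forall fun s hs => ?_
        have := hs.1
        have := hμ.nonneg s hs
        simp only [Pi.zero_apply]
        positivity

lemma exp_neg_one_le_pow {r : ℝ} {n : ℕ} (h : 1 - 1 / (2 * ((n : ℝ) + 1)) ≤ r) :
    Real.exp (-1) ≤ r ^ (2 * n + 1) := by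
  have h1 : Real.exp (-(1 / (2 * n + 1 : ℝ))) ≤ r := by
    refine le_trans ?_ h
    have h2 : 1 / (2 * (n : ℝ) + 1) + 1 ≤ Real.exp (1 / (2 * n + 1)) := Real.add_one_le_exp _
    rw [Real.exp_neg]
    calc _ ≤ (1 / (2 * (n : ℝ) + 1) + 1)⁻¹ := by gcongr
      _ = _ := by field_simp; ring
  calc Real.exp (-1) = Real.exp (-(1 / (2 * n + 1 : ℝ))) ^ (2 * n + 1) := by
        rw [← Real.exp_nat_mul]; congr 1; push_cast; field_simp
    _ ≤ _ := by gcongr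

/-- Where 1-s ≤ 1/(2(n+1)) the factor s^(2n+1) is at least 1/e, so the moment controls the tail from
such a point on. About log₂(1+(n+1)(1-y)) doubling steps lead from y to that point, each costing C ≤
2^γ, hence the polynomial factor. -/
lemma IsDHat.tail_le_moment {μ : ℝ → ℝ} (hμ : IsDHat μ) :
    ∃ A : ℝ, 0 < A ∧ ∃ γ : ℕ, ∀ (n : ℕ) (y : ℝ), y ∈ Ico (0 : ℝ) 1 →
      tail μ y ≤ A * (1 + ((n : ℝ) + 1) * (1 - y)) ^ γ * diffMoment μ 0 n := by
  obtain ⟨hw, C, hC, h⟩ := hμ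
  obtain ⟨γ, hγ⟩ := pow_unbounded_of_one_lt C one_lt_two
  refine ⟨Real.exp 1 * 4 ^ γ, by positivity, γ, fun n y hy => ?_⟩
  set X : ℝ := 1 + ((n : ℝ) + 1) * (1 - y) with hX
  have h1y : 0 < 1 - y := by linarith [hy.2]
  have hX1 : 1 ≤ X := by
    have : 0 ≤ ((n : ℝ) + 1) * (1 - y) := by positivity
    linarith
  obtain ⟨m, hm1, hm2⟩ := exists_nat_pow_near (by linarith : 1 ≤ 2 * X) one_lt_two
  set r := 1 - (1 - y) / 2 ^ (m + 1)
  have h2 : (0 : ℝ) < 2 ^ (m + 1) := by positivity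
  have hr : 1 - 1 / (2 * ((n : ℝ) + 1)) ≤ r := by
    have : (1 - y) / 2 ^ (m + 1) ≤ 1 / (2 * ((n : ℝ) + 1)) := by
      rw [div_le_div_iff₀ h2 (by positivity)]
      nlinarith
    linarith
  have hr0 : 0 ≤ r := by
    refine le_trans ?_ hr
    have : 1 / (2 * ((n : ℝ) + 1)) ≤ 1 := by
      rw [div_le_one (by positivity)]
      have : (0 : ℝ) ≤ n := by positivity
      linarith
    linarith
  have hr1 : r < 1 := by
    have : 0 < (1 - y) / 2 ^ (m + 1) := by positivity
    linarith
  have ht : 0 < tail μ r := hw.tail_pos r ⟨hr0, hr1⟩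
  have hb : tail μ r ≤ Real.exp 1 * diffMoment μ 0 n := by
    have h3 := pow_mul_tail_le hw hr0 n
    have h4 := exp_neg_one_le_pow hr
    have h5 : Real.exp (-1) * tail μ r ≤ diffMoment μ 0 n := le_trans (by gcongr) h3
    calc _ = Real.exp 1 * (Real.exp (-1) * tail μ r) := by
          rw [← mul_assoc, ← Real.exp_add]; simp
      _ ≤ _ := by gcongr
  have hCm : C ^ (m + 1) ≤ (4 * X) ^ γ := by
    calc C ^ (m + 1) ≤ (2 ^ γ) ^ (m + 1) := by gcongr
      _ = (2 ^ (m + 1)) ^ γ := by rw [← pow_mul, ← pow_mul, mul_comm]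
      _ ≤ (4 * X) ^ γ := by gcongr; rw [pow_succ]; linarith
  calc tail μ y ≤ C ^ (m + 1) * tail μ r := tail_le_pow_mul_tail hC h hy _
    _ ≤ (4 * X) ^ γ * (Real.exp 1 * diffMoment μ 0 n) := by gcongr
    _ = _ := by rw [mul_pow]; ring

lemma moment_pos {μ : ℝ → ℝ} (hμ : IsRadialWeight μ) (n : ℕ) : 0 < diffMoment μ 0 n :=
  lt_of_lt_of_le (mul_pos (by positivity) (hμ.tail_pos (1 / 2) (by norm_num)))
    (pow_mul_tail_le hμ (r := 1 / 2) (by norm_num) n)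

/-- The moment of `μ` of natural order `N`. -/
noncomputable def natMoment (μ : ℝ → ℝ) (N : ℕ) : ℝ := ∫ s in Ico (0 : ℝ) 1, s ^ N * μ s

lemma diffMoment_zero (μ : ℝ → ℝ) (n : ℕ) : diffMoment μ 0 n = natMoment μ (2 * n + 1) := by
  simp [diffMoment, natMoment]

lemma natMoment_anti {μ : ℝ → ℝ} (hμ : IsRadialWeight μ) {m n : ℕ} (h : m ≤ n) :
    natMoment μ n ≤ natMoment μ m :=
  integral_mul_weight_mono hμ (by fun_prop) (by fun_prop)
    fun _ hs => pow_le_pow_of_le_one hs.1 hs.2.le h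

/-- Below r, one of the two factors s^(2^m) in s^(2^(m+1)) is at most exp(-D); above r the whole
power is at most 1. -/
lemma natMoment_two_pow_succ_le {μ : ℝ → ℝ} (hμ : IsRadialWeight μ) (m : ℕ) {r D : ℝ}
    (hr : 0 ≤ r) (hD : ∀ s, 0 ≤ s → s < r → D / 2 ^ m ≤ 1 - s) :
    natMoment μ (2 ^ (m + 1)) ≤ tail μ r + Real.exp (-D) * natMoment μ (2 ^ m) := by
  have hsub : Ico r 1 ⊆ Ico (0 : ℝ) 1 := Ico_subset_Ico_left hr
  have htail : tail μ r = ∫ s in Ico (0 : ℝ) 1, (Ico r 1).indicator μ s := by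
    rw [setIntegral_indicator measurableSet_Ico, inter_eq_right.2 hsub]; rfl
  unfold natMoment
  rw [htail, ← integral_const_mul, ← integral_add
    (hμ.integrableOn.indicator measurableSet_Ico)
    ((integrableOn_mul_weight hμ (by fun_prop)).const_mul _)]
  refine setIntegral_mono_on (integrableOn_mul_weight hμ (by fun_prop))
    ((hμ.integrableOn.indicator measurableSet_Ico).add
      ((integrableOn_mul_weight hμ (by fun_prop)).const_mul _)) measurableSet_Ico fun s hs => ?_
  have h0 := hs.1
  have hw := hμ.nonneg s hs
  by_cases hsr : s < r
  · rw [indicator_of_notMem (by simp [hsr]), zero_add, ← mul_assoc]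
    refine mul_le_mul_of_nonneg_right ?_ hw
    rw [pow_succ, pow_mul, pow_two]
    refine mul_le_mul_of_nonneg_right ?_ (by positivity)
    calc s ^ 2 ^ m ≤ Real.exp (-(D / 2 ^ m)) ^ 2 ^ m := by
          gcongr
          linarith [Real.add_one_le_exp (-(D / 2 ^ m)), hD s h0 hsr]
      _ = Real.exp (-D) := by
          rw [← Real.exp_nat_mul]; congr 1; push_cast; field_simp
  · rw [indicator_of_mem (show s ∈ Ico r 1 from ⟨not_lt.1 hsr, hs.2⟩)]
    have h1 : s ^ 2 ^ (m + 1) * μ s ≤ 1 * μ s :=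
      mul_le_mul_of_nonneg_right (pow_le_one₀ h0 hs.2.le) hw
    have h2 : 0 ≤ Real.exp (-D) * (s ^ 2 ^ m * μ s) := by positivity
    linarith

/-- Induction on the dyadic order, cutting at distance 2^q/2^(m+1) from 1. The part near 1 costs q
doubling steps; the rest is exp(-2^q/2) times the previous moment. Taking q large makes this gain
beat the doubling constant, so the bound 2C^q reproduces itself. -/
lemma IsDHat.natMoment_two_pow_le {μ : ℝ → ℝ} (hμ : IsDHat μ) :
    ∃ K : ℝ, 0 < K ∧ ∀ m : ℕ, natMoment μ (2 ^ m) ≤ K * tail μ (1 - 1 / 2 ^ (m + 1)) := by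
  obtain ⟨hw, C, hC, h⟩ := hμ
  have hv (m : ℕ) : tail μ (1 - 1 / 2 ^ m) ≤ C * tail μ (1 - 1 / 2 ^ (m + 1)) := by
    have h1 : (1 : ℝ) / 2 ^ m ≤ 1 := div_le_one_of_le₀ (one_le_pow₀ one_le_two) (by positivity)
    have := h (1 - 1 / 2 ^ m) ⟨by linarith, by linarith [show (0 : ℝ) < 1 / 2 ^ m by positivity]⟩
    convert this using 3
    rw [pow_succ]; field_simp; ring
  obtain ⟨q, hq⟩ := pow_unbounded_of_one_lt (4 * C) one_lt_two
  have hexp : Real.exp (-(2 ^ q / 2)) * C ≤ 1 / 2 := by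
    rw [Real.exp_neg, inv_mul_le_iff₀ (Real.exp_pos _)]
    linarith [Real.add_one_le_exp ((2 : ℝ) ^ q / 2)]
  have hv0 (m : ℕ) : 0 ≤ tail μ (1 - 1 / 2 ^ m) := by
    have h1 : (1 : ℝ) / 2 ^ m ≤ 1 := div_le_one_of_le₀ (one_le_pow₀ one_le_two) (by positivity)
    exact (hw.tail_pos _ ⟨by linarith, by linarith [show (0 : ℝ) < 1 / 2 ^ m by positivity]⟩).le
  have key (m : ℕ) : natMoment μ (2 ^ m) ≤ 2 * C ^ q * tail μ (1 - 1 / 2 ^ m) := by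
    induction m with
    | zero =>
      have h1 : natMoment μ (2 ^ 0) ≤ tail μ 0 := by
        have := natMoment_anti hw (Nat.zero_le (2 ^ 0))
        simpa [natMoment, tail] using this
      have h2 : (1 : ℝ) ≤ C ^ q := one_le_pow₀ hC.le
      have h3 := hv0 0
      simp only [pow_zero, div_one, sub_self] at h3 h1 ⊢
      nlinarith
    | succ m ih =>
      set r : ℝ := max 0 (1 - 2 ^ q / 2 ^ (m + 1)) with hr
      have hr1 : r ∈ Ico (0 : ℝ) 1 := by
        refine ⟨le_max_left _ _, max_lt one_pos ?_⟩
        linarith [show (0 : ℝ) < 2 ^ q / 2 ^ (m + 1) by positivity]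
      have h1 := natMoment_two_pow_succ_le hw m hr1.1 (D := 2 ^ q / 2) fun s hs0 hs => by
        rcases lt_max_iff.1 hs with h | h
        · linarith
        · rw [pow_succ, mul_comm, ← div_div] at h
          linarith
      have h2 : tail μ r ≤ C ^ q * tail μ (1 - 1 / 2 ^ (m + 1)) := by
        refine (tail_le_pow_mul_tail hC h hr1 q).trans ?_
        gcongr
        refine tail_anti hw ?_ ?_
        · linarith [div_le_one_of_le₀ (one_le_pow₀ (one_le_two (α := ℝ)) (n := m + 1)) (by positivity)]
        · have : (1 - r) / 2 ^ q ≤ 1 / 2 ^ (m + 1) := by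
            rw [div_le_iff₀ (by positivity)]
            have := le_max_right 0 (1 - (2 : ℝ) ^ q / 2 ^ (m + 1))
            rw [← hr] at this
            calc _ ≤ (2 : ℝ) ^ q / 2 ^ (m + 1) := by linarith
              _ = _ := by ring
          linarith
      have h3 := hv m
      have h4 := hv0 (m + 1)
      calc _ ≤ _ := h1
        _ ≤ C ^ q * tail μ (1 - 1 / 2 ^ (m + 1)) + Real.exp (-(2 ^ q / 2)) *
            (2 * C ^ q * (C * tail μ (1 - 1 / 2 ^ (m + 1)))) := by
          gcongr
          exact ih.trans (by gcongr)
        _ = (1 + 2 * (Real.exp (-(2 ^ q / 2)) * C)) * (C ^ q * tail μ (1 - 1 / 2 ^ (m + 1))) := by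
          ring
        _ ≤ (1 + 2 * (1 / 2)) * (C ^ q * tail μ (1 - 1 / 2 ^ (m + 1))) := by gcongr
        _ = _ := by ring
  refine ⟨2 * C ^ q * C, by positivity, fun m => (key m).trans ?_⟩
  calc _ ≤ 2 * C ^ q * (C * tail μ (1 - 1 / 2 ^ (m + 1))) := by gcongr; exact hv m
    _ = _ := by ring

/-- Both moments are compared with the tail at 1 - 1/(n+1), where the polynomial factor of
`IsDHat.tail_le_moment` is just 2^γ. -/
lemma IsDHat.moment_half_le {μ : ℝ → ℝ} (hμ : IsDHat μ) :
    ∃ C : ℝ, 0 < C ∧ ∀ n : ℕ, diffMoment μ 0 (n / 2) ≤ C * diffMoment μ 0 n := by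
  obtain ⟨K, hK, hmom⟩ := hμ.natMoment_two_pow_le
  obtain ⟨A, hA, γ, htail⟩ := hμ.tail_le_moment
  refine ⟨K * (A * 2 ^ γ), by positivity, fun n => ?_⟩
  obtain ⟨m, hm1, hm2⟩ := exists_nat_pow_near (by omega : 1 ≤ 2 * (n / 2) + 1) one_lt_two
  have h1 : diffMoment μ 0 (n / 2) ≤ natMoment μ (2 ^ m) := by
    rw [diffMoment_zero]; exact natMoment_anti hμ.1 hm1
  have hn1 : (0 : ℝ) < n + 1 := by positivity
  have h2 : tail μ (1 - 1 / 2 ^ (m + 1)) ≤ tail μ (1 - 1 / (n + 1)) := by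
    apply tail_anti hμ.1
    · linarith [div_le_one_of_le₀ (by linarith : (1 : ℝ) ≤ n + 1) hn1.le]
    · have : ((n : ℝ) + 1) ≤ 2 ^ (m + 1) := by
        have : n + 1 ≤ 2 ^ (m + 1) := by omega
        exact_mod_cast this
      have : (1 : ℝ) / 2 ^ (m + 1) ≤ 1 / (n + 1) := by gcongr
      linarith
  have h3 := htail n (1 - 1 / (n + 1)) ⟨by
    linarith [div_le_one_of_le₀ (by linarith : (1 : ℝ) ≤ n + 1) hn1.le], by
    linarith [show (0 : ℝ) < 1 / (n + 1) by positivity]⟩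
  rw [show (1 : ℝ) + (n + 1) * (1 - (1 - 1 / (n + 1))) = 2 by field_simp; ring] at h3
  calc _ ≤ _ := h1
    _ ≤ K * tail μ (1 - 1 / 2 ^ (m + 1)) := hmom m
    _ ≤ K * (A * 2 ^ γ * diffMoment μ 0 n) := by gcongr; exact h2.trans h3
    _ = _ := by ring

/-- The right side telescopes into i+1 differences, which decrease in the index, so each is at least
the last one. -/
lemma succ_mul_diffMoment_le {μ : ℝ → ℝ} (hμ : IsRadialWeight μ) (j m i : ℕ) :
    ((i : ℝ) + 1) * diffMoment μ (j + 1) (m + i) ≤ diffMoment μ j m - diffMoment μ j (m + i + 1) := by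
  induction i with
  | zero => simp [diffMoment_succ hμ]
  | succ i ih =>
    have h1 := diffMoment_anti hμ (j + 1) (show m + i ≤ m + (i + 1) by omega)
    have h2 := diffMoment_succ hμ j (m + (i + 1))
    have h3 : ((i : ℝ) + 1) * diffMoment μ (j + 1) (m + (i + 1)) ≤
      (i + 1) * diffMoment μ (j + 1) (m + i) := by gcongr
    rw [show m + i + 1 = m + (i + 1) by ring] at ih
    push_cast
    nlinarith

/-- Each difference gains 2/(n+1) by averaging over the indices from n/2 to n;
`IsDHat.moment_half_le` then brings the index n/2 back to n. -/
lemma IsDHat.diffMoment_le {μ : ℝ → ℝ} (hμ : IsDHat μ) (j : ℕ) :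
    ∃ C : ℝ, 0 < C ∧ ∀ n : ℕ, diffMoment μ j n ≤ C * (diffMoment μ 0 n / ((n : ℝ) + 1) ^ j) := by
  obtain ⟨D, hD, hhalf⟩ := hμ.moment_half_le
  induction j with
  | zero => exact ⟨1, one_pos, fun n => by simp⟩
  | succ j ih =>
    obtain ⟨C, hC, ih⟩ := ih
    refine ⟨2 * (C * D * 2 ^ j), by positivity, fun n => ?_⟩
    have h1 := succ_mul_diffMoment_le hμ.1 j (n / 2) (n - n / 2)
    rw [show n / 2 + (n - n / 2) = n by omega] at h1
    have h2 := diffMoment_nonneg hμ.1 j (n + 1)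
    have h3 := diffMoment_nonneg hμ.1 (j + 1) n
    have h4 : ((n : ℝ) + 1) / 2 ≤ ((n - n / 2 : ℕ) : ℝ) + 1 := by
      have : n ≤ 2 * (n - n / 2) := by omega
      have : (n : ℝ) ≤ 2 * ((n - n / 2 : ℕ) : ℝ) := by exact_mod_cast this
      linarith
    have h5 : ((n : ℝ) + 1) / 2 ≤ ((n / 2 : ℕ) : ℝ) + 1 := by
      have : n ≤ 2 * (n / 2) + 1 := by omega
      have : (n : ℝ) ≤ 2 * ((n / 2 : ℕ) : ℝ) + 1 := by exact_mod_cast this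
      linarith
    have hb := moment_pos hμ.1 n
    have h6 : diffMoment μ j (n / 2) ≤ C * (D * diffMoment μ 0 n / (((n : ℝ) + 1) / 2) ^ j) := by
      refine (ih (n / 2)).trans ?_
      gcongr
      exact hhalf n
    have h7 : ((n : ℝ) + 1) / 2 * diffMoment μ (j + 1) n ≤
        C * (D * diffMoment μ 0 n / (((n : ℝ) + 1) / 2) ^ j) := by
      have : ((n : ℝ) + 1) / 2 * diffMoment μ (j + 1) n ≤
        (((n - n / 2 : ℕ) : ℝ) + 1) * diffMoment μ (j + 1) n := by gcongr
      linarith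
    rw [← le_div_iff₀' (by positivity)] at h7
    refine h7.trans (le_of_eq ?_)
    rw [div_pow, pow_succ]; field_simp

/-! ### Calculus of sequences with symbol-type difference bounds -/

/-- `IsSymbol J h x` says that the `j`-th differences of `x` are `O(h n / (n + 1) ^ j)` for all
`j ≤ J`. -/
def IsSymbol : ℕ → (ℕ → ℝ) → (ℕ → ℝ) → Prop
  | 0, h, x => ∃ C : ℝ, 0 ≤ C ∧ ∀ n, |x n| ≤ C * h n
  | J + 1, h, x => (∃ C : ℝ, 0 ≤ C ∧ ∀ n, |x n| ≤ C * h n) ∧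
      IsSymbol J (fun n => h n / ((n : ℝ) + 1)) (fwdDiff 1 x)

namespace IsSymbol

variable {J : ℕ} {h k x y : ℕ → ℝ}

lemma mono (hx : IsSymbol J h x) {D : ℝ} (hD : 0 ≤ D) (hhk : ∀ n, h n ≤ D * k n) :
    IsSymbol J k x := by
  have key : ∀ {h k : ℕ → ℝ} {x : ℕ → ℝ}, (∀ n, h n ≤ D * k n) →
      (∃ C : ℝ, 0 ≤ C ∧ ∀ n, |x n| ≤ C * h n) → ∃ C : ℝ, 0 ≤ C ∧ ∀ n, |x n| ≤ C * k n := by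
    rintro h k x hhk ⟨C, hC, hx⟩
    refine ⟨C * D, by positivity, fun n => (hx n).trans ?_⟩
    rw [mul_assoc]
    gcongr
    exact hhk n
  induction J generalizing h k x with
  | zero => exact key hhk hx
  | succ J ih =>
    refine ⟨key hhk hx.1, ih hx.2 fun n => ?_⟩
    rw [← mul_div_assoc]
    gcongr
    exact hhk n

lemma of_succ (hx : IsSymbol (J + 1) h x) : IsSymbol J h x := by
  induction J generalizing h x with
  | zero => exact hx.1
  | succ J ih => exact ⟨hx.1, ih hx.2⟩

lemma add (hx : IsSymbol J h x) (hy : IsSymbol J h y) : IsSymbol J h (fun n => x n + y n) := by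
  have key : ∀ {h x y : ℕ → ℝ}, (∃ C : ℝ, 0 ≤ C ∧ ∀ n, |x n| ≤ C * h n) →
      (∃ C : ℝ, 0 ≤ C ∧ ∀ n, |y n| ≤ C * h n) →
      ∃ C : ℝ, 0 ≤ C ∧ ∀ n, |x n + y n| ≤ C * h n := by
    rintro h x y ⟨C, hC, hx⟩ ⟨D, hD, hy⟩
    refine ⟨C + D, by positivity, fun n => (abs_add_le _ _).trans ?_⟩
    linarith [hx n, hy n]
  induction J generalizing h x y with
  | zero => exact key hx hy
  | succ J ih =>
    refine ⟨key hx.1 hy.1, ?_⟩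
    convert ih hx.2 hy.2 using 1
    ext n
    simp only [fwdDiff]; ring

lemma neg (hx : IsSymbol J h x) : IsSymbol J h (fun n => -x n) := by
  induction J generalizing h x with
  | zero =>
    obtain ⟨C, hC, hx⟩ := hx
    exact ⟨C, hC, fun n => by simpa using hx n⟩
  | succ J ih =>
    obtain ⟨⟨C, hC, hx⟩, hx'⟩ := hx
    refine ⟨⟨C, hC, fun n => by simpa using hx n⟩, ?_⟩
    convert ih hx' using 1
    ext n
    simp only [fwdDiff]; ring

lemma shift (hh : ∀ n, 0 ≤ h n) (hx : IsSymbol (J + 1) h x) :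
    IsSymbol J h (fun n => x (n + 1)) := by
  have h1 : IsSymbol J h (fwdDiff 1 x) := hx.2.mono zero_le_one fun n => by
    rw [one_mul]
    exact div_le_self (hh n) (by linarith [show (0 : ℝ) ≤ n by positivity])
  convert hx.of_succ.add h1 using 1
  ext n
  simp only [fwdDiff]; ring

/-- Discrete Leibniz rule: Δ(xy)(n) = Δx(n) y(n) + x(n+1) Δy(n). The shifted factor costs one order,
which the induction has to spare. -/
lemma mul (hh : ∀ n, 0 ≤ h n) (hk : ∀ n, 0 ≤ k n) (hx : IsSymbol J h x) (hy : IsSymbol J k y) :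
    IsSymbol J (fun n => h n * k n) (fun n => x n * y n) := by
  have key : ∀ {h k x y : ℕ → ℝ}, (∃ C : ℝ, 0 ≤ C ∧ ∀ n, |x n| ≤ C * h n) →
      (∃ C : ℝ, 0 ≤ C ∧ ∀ n, |y n| ≤ C * k n) →
      ∃ C : ℝ, 0 ≤ C ∧ ∀ n, |x n * y n| ≤ C * (h n * k n) := by
    rintro h k x y ⟨C, hC, hx⟩ ⟨D, hD, hy⟩
    refine ⟨C * D, by positivity, fun n => ?_⟩
    rw [abs_mul, mul_mul_mul_comm]
    exact mul_le_mul (hx n) (hy n) (abs_nonneg _) ((abs_nonneg _).trans (hx n))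
  induction J generalizing h k x y with
  | zero => exact key hx hy
  | succ J ih =>
    refine ⟨key hx.1 hy.1, ?_⟩
    have hh' (n : ℕ) : 0 ≤ h n / ((n : ℝ) + 1) := div_nonneg (hh n) (by positivity)
    have hk' (n : ℕ) : 0 ≤ k n / ((n : ℝ) + 1) := div_nonneg (hk n) (by positivity)
    have h1 := ih hh' hk hx.2 hy.of_succ
    have h2 := ih hh hk' (hx.shift hh) hy.2
    have e1 : (fun n => h n / ((n : ℝ) + 1) * k n) = fun n => h n * k n / ((n : ℝ) + 1) := by
      ext n; ring
    have e2 : (fun n => h n * (k n / ((n : ℝ) + 1))) = fun n => h n * k n / ((n : ℝ) + 1) := by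
      ext n; ring
    rw [e1] at h1
    rw [e2] at h2
    convert h1.add h2 using 1
    ext n
    simp only [fwdDiff]; ring

lemma const (J : ℕ) (c : ℝ) : IsSymbol J (fun _ => 1) (fun _ => c) := by
  have zero : ∀ (J : ℕ) (h : ℕ → ℝ), IsSymbol J h (fun _ => 0) := by
    intro J
    induction J with
    | zero => exact fun h => ⟨0, le_rfl, by simp⟩
    | succ J ih => exact fun h => ⟨⟨0, le_rfl, by simp⟩, by simpa using ih _⟩
  cases J with
  | zero => exact ⟨|c|, abs_nonneg _, by simp⟩
  | succ J => exact ⟨⟨|c|, abs_nonneg _, by simp⟩, by simpa using zero J _⟩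

lemma add_natCast (J i : ℕ) :
    IsSymbol J (fun n => (n : ℝ) + 1) (fun n => (n : ℝ) + 1 + i) := by
  have key : ∃ C : ℝ, 0 ≤ C ∧ ∀ n : ℕ, |(n : ℝ) + 1 + i| ≤ C * ((n : ℝ) + 1) := by
    refine ⟨1 + i, by positivity, fun n => ?_⟩
    rw [abs_of_nonneg (by positivity)]
    nlinarith [show (0 : ℝ) ≤ n * i by positivity]
  cases J with
  | zero => exact key
  | succ J =>
    refine ⟨key, ?_⟩
    convert const J 1 using 1
    · ext n
      field_simp
    · ext n
      simp [fwdDiff]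

lemma ascFactorial (J M : ℕ) :
    IsSymbol J (fun n => ((n : ℝ) + 1) ^ M) (fun n => ((n + 1).ascFactorial M : ℝ)) := by
  induction M with
  | zero => simpa using const J 1
  | succ M ih =>
    convert (add_natCast J M).mul (fun n => by positivity) (fun n => by positivity) ih using 1
    · ext n; ring
    · ext n; rw [Nat.ascFactorial_succ]; push_cast; ring

/-- Δ(1/b)(n) = -Δb(n) / (b(n) b(n+1)). The induction hypothesis is applied to b and to its shift,
and `hbD` lets the shifted reciprocal be measured by 1/b(n). -/
lemma inv {b : ℕ → ℝ} (hb : ∀ n, 0 < b n) {D : ℝ} (hD : 0 ≤ D) (hbD : ∀ n, b n ≤ D * b (n + 1))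
    (h : IsSymbol J b b) : IsSymbol J (fun n => (b n)⁻¹) (fun n => (b n)⁻¹) := by
  have key : ∀ {b : ℕ → ℝ}, (∀ n, 0 < b n) →
      ∃ C : ℝ, 0 ≤ C ∧ ∀ n, |(b n)⁻¹| ≤ C * (b n)⁻¹ := fun {b} hb =>
    ⟨1, zero_le_one, fun n => by rw [one_mul, abs_of_pos (inv_pos.2 (hb n))]⟩
  induction J generalizing b with
  | zero => exact key hb
  | succ J ih =>
    refine ⟨key hb, ?_⟩
    have hinv : ∀ n, 0 ≤ (b n)⁻¹ := fun n => (inv_pos.2 (hb n)).le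
    have h1 := ih hb hbD h.of_succ
    have hs : IsSymbol J b (fun n => b (n + 1)) := h.shift fun n => (hb n).le
    have h2 : IsSymbol J (fun n => (b (n + 1))⁻¹) (fun n => (b (n + 1))⁻¹) :=
      ih (fun n => hb (n + 1)) (fun n => hbD (n + 1)) (hs.mono hD hbD)
    have h3 : IsSymbol J (fun n => (b n)⁻¹) (fun n => (b (n + 1))⁻¹) :=
      h2.mono hD fun n => by
        have := hbD n
        rw [← div_eq_mul_inv, le_div_iff₀ (hb n), inv_mul_le_iff₀ (hb (n + 1))]
        linarith
    have h4 := (h.2.mul (fun n => div_nonneg (hb n).le (by positivity)) hinv h1).mul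
      (fun n => mul_nonneg (div_nonneg (hb n).le (by positivity)) (hinv n)) hinv h3
    convert h4.neg using 1
    · ext n
      have := (hb n).ne'
      field_simp
    · ext n
      have h5 := (hb n).ne'
      have h6 := (hb (n + 1)).ne'
      simp only [fwdDiff]
      field_simp
      ring

lemma iterate_bound (hx : IsSymbol J h x) :
    ∃ C : ℝ, 0 ≤ C ∧ ∀ n, |(fwdDiff 1)^[J] x n| ≤ C * (h n / ((n : ℝ) + 1) ^ J) := by
  induction J generalizing h x with
  | zero => simpa [IsSymbol] using hx
  | succ J ih =>
    obtain ⟨C, hC, hx⟩ := ih hx.2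
    refine ⟨C, hC, fun n => ?_⟩
    rw [Function.iterate_succ_apply]
    refine (hx n).trans (le_of_eq ?_)
    rw [pow_succ', ← div_div]

end IsSymbol

/-- Differencing only raises j, up to sign, so the size bounds for every j suffice. -/
lemma IsDHat.isSymbol_diffMoment {μ : ℝ → ℝ} (hμ : IsDHat μ) (J j : ℕ) :
    IsSymbol J (fun n => diffMoment μ 0 n / ((n : ℝ) + 1) ^ j) (diffMoment μ j) := by
  have key (j : ℕ) : ∃ C : ℝ, 0 ≤ C ∧
      ∀ n, |diffMoment μ j n| ≤ C * (diffMoment μ 0 n / ((n : ℝ) + 1) ^ j) := by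
    obtain ⟨C, hC, h⟩ := hμ.diffMoment_le j
    exact ⟨C, hC.le, fun n => by rw [abs_of_nonneg (diffMoment_nonneg hμ.1 j n)]; exact h n⟩
  induction J generalizing j with
  | zero => exact key j
  | succ J ih =>
    refine ⟨key j, ?_⟩
    convert (ih (j + 1)).neg using 1
    · ext n
      rw [pow_succ, ← div_div]
    · ext n
      simp [fwdDiff, diffMoment_succ hμ.1]

/-! ### Kernel estimate by summation by parts -/

/-- The `n`-th coefficient of the kernel representing `D^μ` after `M` radial derivatives. -/
noncomputable def kernelCoeff (μ : ℝ → ℝ) (M n : ℕ) : ℝ :=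
  (diffMoment μ 0 n)⁻¹ * (n + 1).ascFactorial M

lemma IsDHat.isSymbol_kernelCoeff {μ : ℝ → ℝ} (hμ : IsDHat μ) (J M : ℕ) :
    IsSymbol J (fun n => (diffMoment μ 0 n)⁻¹ * ((n : ℝ) + 1) ^ M) (kernelCoeff μ M) := by
  obtain ⟨C, hC, h⟩ := hμ.moment_half_le
  have h0 : IsSymbol J (diffMoment μ 0) (diffMoment μ 0) := by
    simpa using hμ.isSymbol_diffMoment J 0
  refine (h0.inv (moment_pos hμ.1) hC.le fun n => ?_).mul
    (fun n => (inv_pos.2 (moment_pos hμ.1 n)).le) (fun n => by positivity)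
    (IsSymbol.ascFactorial J M)
  exact (diffMoment_anti hμ.1 0 (by omega)).trans (h (n + 1))

/-- A sequence of polynomial growth. -/
def PolyBdd (c : ℕ → ℝ) : Prop := ∃ (A : ℝ) (q : ℕ), ∀ n : ℕ, |c n| ≤ A * ((n : ℝ) + 1) ^ q

lemma summable_succ_pow_mul_geometric (q : ℕ) {y : ℝ} (hy0 : 0 ≤ y) (hy : y < 1) :
    Summable fun n : ℕ => ((n : ℝ) + 1) ^ q * y ^ n := by
  have h := (summable_choose_mul_geometric_of_norm_lt_one (R := ℝ) q
    (by rwa [Real.norm_of_nonneg hy0])).mul_left (q.factorial : ℝ)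
  refine h.of_nonneg_of_le (fun n => by positivity) fun n => ?_
  rw [← mul_assoc]
  refine mul_le_mul_of_nonneg_right ?_ (by positivity)
  have := Nat.pow_succ_le_ascFactorial (n + 1) q
  rw [Nat.ascFactorial_eq_factorial_mul_choose] at this
  exact_mod_cast this

lemma PolyBdd.summable {c : ℕ → ℝ} (hc : PolyBdd c) {y : ℝ} (hy0 : 0 ≤ y) (hy : y < 1) :
    Summable fun n : ℕ => |c n| * y ^ n := by
  obtain ⟨A, q, h⟩ := hc
  refine ((summable_succ_pow_mul_geometric q hy0 hy).mul_left A).of_nonneg_of_le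
    (fun n => by positivity) fun n => ?_
  rw [← mul_assoc]
  exact mul_le_mul_of_nonneg_right (h n) (by positivity)

lemma PolyBdd.summable_norm {c : ℕ → ℝ} (hc : PolyBdd c) {x : ℂ} (hx : ‖x‖ < 1) :
    Summable fun n : ℕ => ‖(c n : ℂ) * x ^ n‖ := by
  simpa using hc.summable (norm_nonneg x) hx

lemma PolyBdd.fwdDiff {c : ℕ → ℝ} (hc : PolyBdd c) : PolyBdd (fwdDiff 1 c) := by
  obtain ⟨A, q, h⟩ := hc
  have hA : 0 ≤ A := by have := (abs_nonneg _).trans (h 0); simpa using this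
  refine ⟨A * 2 ^ q + A, q, fun n => ?_⟩
  have h1 : |c (n + 1)| ≤ A * 2 ^ q * ((n : ℝ) + 1) ^ q := by
    refine (h (n + 1)).trans ?_
    rw [mul_assoc, ← mul_pow]
    gcongr
    push_cast
    linarith [show (0 : ℝ) ≤ n by positivity]
  calc |c (n + 1) - c n| ≤ |c (n + 1)| + |c n| := abs_sub _ _
    _ ≤ _ := by rw [add_mul]; exact add_le_add h1 (h n)

lemma one_sub_mul_tsum {c : ℕ → ℝ} (hc : PolyBdd c) {x : ℂ} (hx : ‖x‖ < 1) :
    (1 - x) * ∑' n, (c n : ℂ) * x ^ n = c 0 + x * ∑' n, ((fwdDiff 1 c n : ℝ) : ℂ) * x ^ n := by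
  have h0 : Summable fun n : ℕ => (c n : ℂ) * x ^ n := (hc.summable_norm hx).of_norm
  have h1 : Summable fun n : ℕ => (c (n + 1) : ℂ) * x ^ (n + 1) := (summable_nat_add_iff 1).2 h0
  have h2 := h0.tsum_eq_zero_add
  have h3 : x * ∑' n, ((fwdDiff 1 c n : ℝ) : ℂ) * x ^ n =
      ∑' n, (c (n + 1) : ℂ) * x ^ (n + 1) - x * ∑' n, (c n : ℂ) * x ^ n := by
    rw [← tsum_mul_left, ← tsum_mul_left, ← h1.tsum_sub (h0.mul_left x)]
    congr 1; ext n
    simp only [fwdDiff]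
    push_cast
    ring
  rw [h3, sub_mul, one_mul, pow_zero, mul_one] at *
  linear_combination h2

/-- Each summation by parts trades a factor 1-x for a difference of the coefficients; `B` collects
the boundary terms, using |1-x| ≤ 2. -/
lemma norm_one_sub_pow_mul_tsum_le (J : ℕ) {c : ℕ → ℝ} (hc : PolyBdd c) :
    ∃ B : ℝ, 0 ≤ B ∧ ∀ x : ℂ, ‖x‖ < 1 → ‖1 - x‖ ^ J * ‖∑' n, (c n : ℂ) * x ^ n‖ ≤
      B + ∑' n, |(fwdDiff 1)^[J] c n| * ‖x‖ ^ n := by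
  induction J generalizing c with
  | zero =>
    refine ⟨0, le_rfl, fun x hx => ?_⟩
    rw [pow_zero, one_mul, zero_add]
    refine (norm_tsum_le_tsum_norm (hc.summable_norm hx)).trans (le_of_eq ?_)
    simp
  | succ J ih =>
    obtain ⟨B, hB, h⟩ := ih hc.fwdDiff
    refine ⟨2 ^ J * |c 0| + B, by positivity, fun x hx => ?_⟩
    have h1 : ‖1 - x‖ ≤ 2 := (norm_sub_le _ _).trans (by rw [norm_one]; linarith)
    have h2 : ‖(1 - x) * ∑' n, (c n : ℂ) * x ^ n‖ ≤
        |c 0| + ‖∑' n, ((fwdDiff 1 c n : ℝ) : ℂ) * x ^ n‖ := by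
      rw [one_sub_mul_tsum hc hx]
      refine (norm_add_le _ _).trans ?_
      rw [norm_mul]
      gcongr
      · simp
      · exact mul_le_of_le_one_left (norm_nonneg _) hx.le
    rw [norm_mul] at h2
    calc _ = ‖1 - x‖ ^ J * (‖1 - x‖ * ‖∑' n, (c n : ℂ) * x ^ n‖) := by rw [pow_succ]; ring
      _ ≤ ‖1 - x‖ ^ J * (|c 0| + ‖∑' n, ((fwdDiff 1 c n : ℝ) : ℂ) * x ^ n‖) := by gcongr
      _ = ‖1 - x‖ ^ J * |c 0| + ‖1 - x‖ ^ J * ‖∑' n, ((fwdDiff 1 c n : ℝ) : ℂ) * x ^ n‖ := by ring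
      _ ≤ 2 ^ J * |c 0| + (B + ∑' n, |(fwdDiff 1)^[J] (fwdDiff 1 c) n| * ‖x‖ ^ n) := by
        gcongr
        exact h x hx
      _ = _ := by rw [Function.iterate_succ_apply]; ring

/-- Split (1+a)^γ ≤ 2^(γ-1)(1+a^γ) and compare (n+1)^γ with γ! times a binomial coefficient; the
negative binomial series then sums to (1-y)^(-γ-1). -/
lemma tsum_one_add_pow_mul_geometric_le (γ : ℕ) :
    ∃ C : ℝ, 0 < C ∧ ∀ y : ℝ, 0 ≤ y → y < 1 →
      (Summable fun n : ℕ => (1 + ((n : ℝ) + 1) * (1 - y)) ^ γ * y ^ n) ∧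
      ∑' n : ℕ, (1 + ((n : ℝ) + 1) * (1 - y)) ^ γ * y ^ n ≤ C / (1 - y) := by
  refine ⟨2 ^ (γ - 1) * (1 + γ.factorial), by positivity, fun y hy0 hy => ?_⟩
  have h1y : 0 < 1 - y := by linarith
  have hyn : ‖y‖ < 1 := by rwa [Real.norm_of_nonneg hy0]
  have hs := ((hasSum_geometric_of_lt_one hy0 hy).add
    ((hasSum_choose_mul_geometric_of_norm_lt_one γ hyn).mul_left
      (γ.factorial * (1 - y) ^ γ))).mul_left (2 ^ (γ - 1) : ℝ)
  have hle (n : ℕ) : (1 + ((n : ℝ) + 1) * (1 - y)) ^ γ * y ^ n ≤ 2 ^ (γ - 1) *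
      (y ^ n + γ.factorial * (1 - y) ^ γ * ((n + γ).choose γ * y ^ n)) := by
    have h2 := add_pow_le (zero_le_one (α := ℝ))
      (by positivity : 0 ≤ ((n : ℝ) + 1) * (1 - y)) γ
    have h3 : ((n : ℝ) + 1) ^ γ ≤ γ.factorial * (n + γ).choose γ := by
      have := Nat.pow_succ_le_ascFactorial (n + 1) γ
      rw [Nat.ascFactorial_eq_factorial_mul_choose] at this
      exact_mod_cast this
    calc _ ≤ 2 ^ (γ - 1) * (1 ^ γ + (((n : ℝ) + 1) * (1 - y)) ^ γ) * y ^ n := by gcongr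
      _ = 2 ^ (γ - 1) * (1 + ((n : ℝ) + 1) ^ γ * (1 - y) ^ γ) * y ^ n := by
        rw [one_pow, mul_pow]
      _ ≤ 2 ^ (γ - 1) * (1 + γ.factorial * (n + γ).choose γ * (1 - y) ^ γ) * y ^ n := by gcongr
      _ = _ := by ring
  have hsum : Summable fun n : ℕ => (1 + ((n : ℝ) + 1) * (1 - y)) ^ γ * y ^ n :=
    hs.summable.of_nonneg_of_le (fun n => by positivity) hle
  refine ⟨hsum, (hasSum_le hle hsum.hasSum hs).trans (le_of_eq ?_)⟩
  rw [pow_succ]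
  field_simp

lemma IsDHat.inv_moment_mul_tail_le {μ : ℝ → ℝ} (hμ : IsDHat μ) :
    ∃ A : ℝ, 0 < A ∧ ∃ γ : ℕ, ∀ (n : ℕ) (y : ℝ), y ∈ Ico (0 : ℝ) 1 →
      (diffMoment μ 0 n)⁻¹ * tail μ y ≤ A * (1 + ((n : ℝ) + 1) * (1 - y)) ^ γ := by
  obtain ⟨A, hA, γ, h⟩ := hμ.tail_le_moment
  refine ⟨A, hA, γ, fun n y hy => ?_⟩
  rw [inv_mul_le_iff₀ (moment_pos hμ.1 n), mul_comm]
  exact h n y hy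

lemma IsDHat.polyBdd_inv_moment {μ : ℝ → ℝ} (hμ : IsDHat μ) :
    PolyBdd fun n => (diffMoment μ 0 n)⁻¹ := by
  obtain ⟨A, hA, γ, h⟩ := hμ.inv_moment_mul_tail_le
  have ht : 0 < tail μ 0 := hμ.1.tail_pos 0 (by norm_num)
  refine ⟨A * 2 ^ γ / tail μ 0, γ, fun n => ?_⟩
  rw [abs_of_pos (inv_pos.2 (moment_pos hμ.1 n)), div_mul_eq_mul_div, le_div_iff₀ ht, mul_assoc,
    ← mul_pow]
  refine (h n 0 (by norm_num)).trans ?_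
  have : (0 : ℝ) ≤ n := by positivity
  gcongr
  linarith

lemma IsDHat.polyBdd_kernelCoeff {μ : ℝ → ℝ} (hμ : IsDHat μ) (M : ℕ) :
    PolyBdd (kernelCoeff μ M) := by
  obtain ⟨A, q, h⟩ := hμ.polyBdd_inv_moment
  obtain ⟨C, hC, hc⟩ := hμ.isSymbol_kernelCoeff 0 M
  refine ⟨C * A, q + M, fun n => (hc n).trans ?_⟩
  have := (le_abs_self _).trans (h n)
  calc C * ((diffMoment μ 0 n)⁻¹ * ((n : ℝ) + 1) ^ M) ≤ C * (A * ((n : ℝ) + 1) ^ q * ((n : ℝ) + 1) ^ M) := by gcongr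
    _ = _ := by rw [pow_add]; ring

/-- The kernel representing `D^μ` after `M` radial derivatives. -/
noncomputable def kernel (μ : ℝ → ℝ) (M : ℕ) (x : ℂ) : ℂ := ∑' n, (kernelCoeff μ M n : ℂ) * x ^ n

/-- Exactly M differences cancel the growth (n+1)^M, leaving the series of |x|^n / μ_{2n+1}.
Bounding 1/μ_{2n+1} by a power of 1+(n+1)(1-|x|) over the tail at |x| makes it summable to the
stated size. -/
lemma IsDHat.kernel_bound {μ : ℝ → ℝ} (hμ : IsDHat μ) (M : ℕ) :
    ∃ C : ℝ, 0 < C ∧ ∀ x : ℂ, ‖x‖ < 1 →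
      ‖kernel μ M x‖ ≤ C / ((1 - ‖x‖) * tail μ ‖x‖ * ‖1 - x‖ ^ M) := by
  obtain ⟨A, hA, γ, hmom⟩ := hμ.inv_moment_mul_tail_le
  obtain ⟨G, hG, hgeom⟩ := tsum_one_add_pow_mul_geometric_le γ
  obtain ⟨D, hD, hdiff⟩ := (hμ.isSymbol_kernelCoeff M M).iterate_bound
  obtain ⟨B, hB, hparts⟩ := norm_one_sub_pow_mul_tsum_le M (hμ.polyBdd_kernelCoeff M)
  have ht0 := hμ.1.tail_pos 0 (by norm_num)
  refine ⟨B * tail μ 0 + D * (A * G) + 1, by positivity, fun x hx => ?_⟩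
  set y := ‖x‖
  have hy0 : 0 ≤ y := norm_nonneg x
  have h1y : 0 < 1 - y := by linarith
  have ht := hμ.1.tail_pos y ⟨hy0, hx⟩
  have hx1 : 0 < ‖1 - x‖ := norm_pos_iff.2 fun h => by
    rw [sub_eq_zero] at h
    simp [y, ← h] at hx
  obtain ⟨hs, hsum⟩ := hgeom y hy0 hx
  have hterm (n : ℕ) : |(fwdDiff 1)^[M] (kernelCoeff μ M) n| * y ^ n ≤
      D * A / tail μ y * ((1 + ((n : ℝ) + 1) * (1 - y)) ^ γ * y ^ n) := by
    rw [← mul_assoc]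
    refine mul_le_mul_of_nonneg_right ((hdiff n).trans ?_) (by positivity)
    have := hmom n y ⟨hy0, hx⟩
    rw [← le_div_iff₀ ht] at this
    rw [mul_div_cancel_right₀ _ (by positivity)]
    calc _ ≤ D * (A * (1 + ((n : ℝ) + 1) * (1 - y)) ^ γ / tail μ y) := by gcongr
      _ = _ := by ring
  have hsum2 : ∑' n, |(fwdDiff 1)^[M] (kernelCoeff μ M) n| * y ^ n ≤
      D * A / tail μ y * (G / (1 - y)) := by
    have hs' := hs.mul_left (D * A / tail μ y)
    refine (Summable.tsum_le_tsum hterm (hs'.of_nonneg_of_le (fun n => by positivity) hterm)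
      hs').trans ?_
    rw [tsum_mul_left]
    gcongr
  have hmain := (hparts x hx).trans (add_le_add_right hsum2 B)
  rw [le_div_iff₀ (by positivity)]
  have htail : tail μ y ≤ tail μ 0 := tail_anti hμ.1 le_rfl hy0
  calc ‖kernel μ M x‖ * ((1 - y) * tail μ y * ‖1 - x‖ ^ M)
      = (‖1 - x‖ ^ M * ‖kernel μ M x‖) * ((1 - y) * tail μ y) := by ring
    _ ≤ (B + D * A / tail μ y * (G / (1 - y))) * ((1 - y) * tail μ y) := by
      gcongr
      exact hmain
    _ = B * ((1 - y) * tail μ y) + D * (A * G) := by field_simp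
    -- The boundary terms are harmless because (1-y) tail(y) is bounded by the full mass.
    _ ≤ B * (1 * tail μ 0) + D * (A * G) := by
      gcongr
      linarith
    _ ≤ _ := by linarith

/-! ### Poisson majorant of |F|^p -/

lemma norm_circleAverage_le {E : Type*} [NormedAddCommGroup E] [NormedSpace ℝ E] (f : ℂ → E)
    (c : ℂ) (R : ℝ) :
    ‖Real.circleAverage f c R‖ ≤ Real.circleAverage (fun z => ‖f z‖) c R := by
  rw [Real.circleAverage, Real.circleAverage, norm_smul, smul_eq_mul,
    Real.norm_of_nonneg (by positivity)]
  gcongr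
  exact intervalIntegral.norm_integral_le_integral_norm (by positivity)

/-- Negative frequencies are conjugated into nonnegative powers without changing the real part.
Since Re is not complex-linear, the multiplier `c` is needed for the scalar step of the induction.
-/
lemma exists_re_eq_of_mem_span_fourier {g : C(AddCircle (2 * Real.pi), ℂ)}
    (hg : g ∈ Submodule.span ℂ (range (@fourier (2 * Real.pi)))) (c : ℂ) :
    ∃ Φ : ℂ → ℂ, Differentiable ℂ Φ ∧
      ∀ θ : ℝ, (c * g θ).re = (Φ (Complex.exp (θ * Complex.I))).re := by
  induction hg using Submodule.span_induction generalizing c with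
  | mem x hx =>
    obtain ⟨n, rfl⟩ := hx
    have hval (θ : ℝ) : fourier n (θ : AddCircle (2 * Real.pi)) =
        Complex.exp (θ * Complex.I) ^ n := by
      rw [fourier_coe_apply, ← Complex.exp_int_mul]
      congr 1
      have : (Real.pi : ℂ) ≠ 0 := by exact_mod_cast Real.pi_ne_zero
      push_cast
      field_simp
    rcases n.eq_nat_or_neg with ⟨m, rfl | rfl⟩
    · exact ⟨fun z => c * z ^ m, by fun_prop, fun θ => by rw [hval, zpow_natCast]⟩
    · refine ⟨fun z => (starRingEnd ℂ) c * z ^ m, by fun_prop, fun θ => ?_⟩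
      rw [hval, ← Complex.conj_re, map_mul, zpow_neg, zpow_natCast, map_inv₀, map_pow,
        ← Complex.exp_conj]
      simp [← Complex.exp_neg, ← inv_pow]
  | zero => exact ⟨fun _ => 0, by fun_prop, by simp⟩
  | add x y _ _ hx hy =>
    obtain ⟨Φ, hΦ, h1⟩ := hx c
    obtain ⟨Ψ, hΨ, h2⟩ := hy c
    refine ⟨fun z => Φ z + Ψ z, hΦ.add hΨ, fun θ => ?_⟩
    rw [ContinuousMap.add_apply, mul_add, Complex.add_re, Complex.add_re, h1, h2]
  | smul a x _ hx =>
    obtain ⟨Φ, hΦ, h1⟩ := hx (c * a)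
    refine ⟨Φ, hΦ, fun θ => ?_⟩
    rw [← h1, ContinuousMap.smul_apply, smul_eq_mul, mul_assoc]

lemma exists_re_approx {h : ℂ → ℝ} (hh : ContinuousOn h (sphere 0 1)) {η : ℝ} (hη : 0 < η) :
    ∃ Φ : ℂ → ℂ, Differentiable ℂ Φ ∧ ∀ z ∈ sphere (0 : ℂ) 1, |(Φ z).re - h z| < η := by
  have : Fact (0 < 2 * Real.pi) := ⟨Real.two_pi_pos⟩
  have hcont : Continuous fun x : AddCircle (2 * Real.pi) => (h (AddCircle.toCircle x) : ℂ) := by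
    refine Complex.continuous_ofReal.comp (hh.comp_continuous ?_ fun x =>
      mem_sphere_zero_iff_norm.2 (Circle.norm_coe _))
    exact continuous_subtype_val.comp AddCircle.continuous_toCircle
  have hmem : (⟨_, hcont⟩ : C(AddCircle (2 * Real.pi), ℂ)) ∈
      (Submodule.span ℂ (range (@fourier (2 * Real.pi)))).topologicalClosure := by
    rw [span_fourier_closure_eq_top]; trivial
  obtain ⟨g, hg, hdist⟩ := Metric.mem_closure_iff.1 hmem η hη
  obtain ⟨Φ, hΦ, hre⟩ := exists_re_eq_of_mem_span_fourier hg 1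
  refine ⟨Φ, hΦ, fun z hz => ?_⟩
  have hz1 : ‖z‖ = 1 := by simpa using hz
  have hexp : Complex.exp (z.arg * Complex.I) = z := by
    simpa [hz1] using Complex.norm_mul_exp_arg_mul_I z
  have h1 := (ContinuousMap.dist_lt_iff hη).1 hdist (z.arg : AddCircle (2 * Real.pi))
  have h2 : ((AddCircle.toCircle (z.arg : AddCircle (2 * Real.pi)) : Circle) : ℂ) = z := by
    rw [AddCircle.toCircle_apply_mk, Circle.coe_exp]
    simpa using hexp
  have h3 := hre z.arg
  rw [hexp, one_mul] at h3
  rw [← h3, dist_comm, dist_eq_norm] at *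
  simp only [ContinuousMap.coe_mk, h2] at h1
  refine lt_of_le_of_lt ?_ h1
  simpa using Complex.abs_re_le_norm (g (z.arg : AddCircle (2 * Real.pi)) - (h z : ℂ))

lemma poissonKernel_zero (w z : ℂ) (hz : ‖z‖ = 1) :
    poissonKernel 0 w z = (1 - ‖w‖ ^ 2) / ‖z - w‖ ^ 2 := by
  simp [poissonKernel_def, hz]

lemma poissonKernel_nonneg {w z : ℂ} (hw : ‖w‖ < 1) (hz : ‖z‖ = 1) :
    0 ≤ poissonKernel 0 w z := by
  rw [poissonKernel_zero w z hz]
  have : 0 ≤ 1 - ‖w‖ ^ 2 := by nlinarith [norm_nonneg w]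
  positivity

lemma continuousOn_poissonKernel {w : ℂ} (hw : ‖w‖ < 1) :
    ContinuousOn (poissonKernel 0 w) (sphere 0 1) := by
  have : ContinuousOn (fun z : ℂ => (1 - ‖w‖ ^ 2) / ‖z - w‖ ^ 2) (sphere 0 1) := by
    refine ContinuousOn.div (by fun_prop) (by fun_prop) fun z hz h => ?_
    have hz1 : ‖z‖ = 1 := by simpa using hz
    rw [pow_eq_zero_iff two_ne_zero, norm_eq_zero, sub_eq_zero] at h
    rw [← h] at hw
    linarith
  exact this.congr fun z hz => poissonKernel_zero w z (by simpa using hz)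

lemma circleIntegrable_of_continuousOn {E : Type*} [NormedAddCommGroup E] {f : ℂ → E}
    (hf : ContinuousOn f (sphere 0 1)) : CircleIntegrable f 0 1 :=
  ContinuousOn.circleIntegrable zero_le_one hf

lemma circleAverage_poissonKernel {w : ℂ} (hw : ‖w‖ < 1) :
    Real.circleAverage (poissonKernel 0 w) 0 1 = 1 := by
  have := (diffContOnCl_const (𝕜 := ℂ) (c := (1 : ℂ)) (s := ball (0 : ℂ) 1)).circleAverage_poissonKernel_smul
    (w := w) (by simpa using hw)
  have h2 := Complex.ofRealCLM.circleAverage_comp_comm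
    (circleIntegrable_of_continuousOn (continuousOn_poissonKernel hw))
  have h3 : (Complex.ofRealCLM ∘ poissonKernel 0 w) = poissonKernel 0 w • fun _ => (1 : ℂ) := by
    ext z; simp
  rw [h3, this] at h2
  rw [Complex.ofRealCLM_apply] at h2
  exact_mod_cast h2.symm

/-- `‖F‖ ^ p` is dominated by the Poisson integral of its boundary values. -/
theorem norm_rpow_le_poisson {F : ℂ → ℂ} (hF : DiffContOnCl ℂ F (ball 0 1)) {p : ℝ} (hp : 0 < p)
    {w : ℂ} (hw : ‖w‖ < 1) :
    ‖F w‖ ^ p ≤ Real.circleAverage (fun z => poissonKernel 0 w z * ‖F z‖ ^ p) 0 1 := by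
  have hFc : ContinuousOn F (sphere 0 1) :=
    hF.continuousOn.mono (by rw [closure_ball _ one_ne_zero]; exact sphere_subset_closedBall)
  have hFp : ContinuousOn (fun z => ‖F z‖ ^ p) (sphere 0 1) :=
    hFc.norm.rpow_const fun _ _ => .inr hp.le
  have hP := continuousOn_poissonKernel hw
  have hwb : w ∈ ball (0 : ℂ) 1 := by simpa using hw
  set A := Real.circleAverage (fun z => poissonKernel 0 w z * ‖F z‖ ^ p) 0 1
  -- Zeros of F are avoided by approximating log(|F|^p + ε) on the circle by the real part of an
  -- entire function. After adding ε, exp(Re Ψ) dominates |F|^p there; the maximum principle for F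
  -- exp(-Ψ/p) carries this inside, and Poisson's formula applies to the holomorphic function
  -- exp(Ψ).
  have key (ε : ℝ) (hε : 0 < ε) : ‖F w‖ ^ p ≤ Real.exp (2 * ε) * (A + ε) := by
    have hpos (z : ℂ) : 0 < ‖F z‖ ^ p + ε := by positivity
    obtain ⟨Φ, hΦ, happ⟩ := exists_re_approx (h := fun z => Real.log (‖F z‖ ^ p + ε))
      ((hFp.add continuousOn_const).log fun z _ => (hpos z).ne') hε
    set Ψ : ℂ → ℂ := fun z => Φ z + ε with hΨdef
    have hΨ : Differentiable ℂ Ψ := hΦ.add_const _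
    have hlow (z : ℂ) (hz : z ∈ sphere (0 : ℂ) 1) : ‖F z‖ ^ p ≤ Real.exp (Ψ z).re := by
      have h1 := (abs_lt.1 (happ z hz)).1
      have h2 : Real.log (‖F z‖ ^ p + ε) ≤ (Ψ z).re := by
        simp only [hΨdef, Complex.add_re, Complex.ofReal_re]; linarith
      have h3 := (Real.log_le_iff_le_exp (hpos z)).1 h2
      linarith
    have hup (z : ℂ) (hz : z ∈ sphere (0 : ℂ) 1) :
        Real.exp (Ψ z).re ≤ Real.exp (2 * ε) * (‖F z‖ ^ p + ε) := by
      have h1 := (abs_lt.1 (happ z hz)).2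
      have h2 : (Ψ z).re ≤ 2 * ε + Real.log (‖F z‖ ^ p + ε) := by
        simp only [hΨdef, Complex.add_re, Complex.ofReal_re]; linarith
      refine (Real.exp_le_exp.2 h2).trans (le_of_eq ?_)
      rw [Real.exp_add, Real.exp_log (hpos z)]
    have hmax : ‖F w * Complex.exp (-Ψ w / p)‖ ≤ 1 := by
      have hd : DiffContOnCl ℂ (fun z => F z * Complex.exp (-Ψ z / p)) (ball 0 1) :=
        hF.smul (by fun_prop : Differentiable ℂ fun z => Complex.exp (-Ψ z / p)).diffContOnCl
      refine Complex.norm_le_of_forall_mem_frontier_norm_le isBounded_ball hd (fun z hz => ?_)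
        (subset_closure hwb)
      rw [frontier_ball _ one_ne_zero] at hz
      have h1 := Real.rpow_le_rpow (by positivity) (hlow z hz) (inv_nonneg.2 hp.le)
      rw [← Real.rpow_mul (norm_nonneg _), mul_inv_cancel₀ hp.ne', Real.rpow_one,
        ← Real.exp_mul] at h1
      have e : (-Ψ z / p).re = -((Ψ z).re * p⁻¹) := by
        rw [Complex.div_ofReal_re, Complex.neg_re, neg_div, div_eq_mul_inv]
      rw [norm_mul, Complex.norm_exp, e, Real.exp_neg]
      exact mul_inv_le_one_of_le₀ h1 (Real.exp_nonneg _)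
    have hw1 : ‖F w‖ ^ p ≤ Real.exp (Ψ w).re := by
      have e : (-Ψ w / p).re = -((Ψ w).re * p⁻¹) := by
        rw [Complex.div_ofReal_re, Complex.neg_re, neg_div, div_eq_mul_inv]
      rw [norm_mul, Complex.norm_exp, e, Real.exp_neg, mul_inv_le_iff₀ (Real.exp_pos _),
        one_mul] at hmax
      refine (Real.rpow_le_rpow (norm_nonneg _) hmax hp.le).trans (le_of_eq ?_)
      rw [← Real.exp_mul, mul_assoc, inv_mul_cancel₀ hp.ne', mul_one]
    have hpoisson := (hΨ.cexp.diffContOnCl (s := ball (0 : ℂ) 1)).circleAverage_poissonKernel_smul hwb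
    have hexpc : ContinuousOn (fun z => Real.exp (Ψ z).re) (sphere 0 1) := by
      have := hΨ.continuous
      fun_prop
    calc ‖F w‖ ^ p ≤ Real.exp (Ψ w).re := hw1
      _ = ‖Complex.exp (Ψ w)‖ := (Complex.norm_exp _).symm
      _ ≤ Real.circleAverage (fun z => ‖(poissonKernel 0 w • fun z => Complex.exp (Ψ z)) z‖) 0 1 := by
        rw [← hpoisson]; exact norm_circleAverage_le _ _ _
      _ = Real.circleAverage (fun z => poissonKernel 0 w z * Real.exp (Ψ z).re) 0 1 := by
        refine Real.circleAverage_congr_sphere fun z hz => ?_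
        have hz1 : ‖z‖ = 1 := by simpa using hz
        simp [Complex.norm_exp, abs_of_nonneg (poissonKernel_nonneg hw hz1)]
      _ ≤ Real.circleAverage (fun z => Real.exp (2 * ε) *
            (poissonKernel 0 w z * ‖F z‖ ^ p + ε * poissonKernel 0 w z)) 0 1 := by
        refine Real.circleAverage_mono (circleIntegrable_of_continuousOn (hP.mul hexpc))
          (circleIntegrable_of_continuousOn
            (continuousOn_const.mul ((hP.mul hFp).add (continuousOn_const.mul hP)))) fun z hz => ?_
        rw [abs_one] at hz
        have hz1 : ‖z‖ = 1 := by simpa using hz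
        calc _ ≤ poissonKernel 0 w z * (Real.exp (2 * ε) * (‖F z‖ ^ p + ε)) :=
              mul_le_mul_of_nonneg_left (hup z hz) (poissonKernel_nonneg hw hz1)
          _ = _ := by ring
      _ = Real.exp (2 * ε) * (A + ε) := by
        have h1 := Real.circleAverage_fun_smul (a := Real.exp (2 * ε)) (c := (0 : ℂ)) (R := 1)
          (f := fun z => poissonKernel 0 w z * ‖F z‖ ^ p + ε * poissonKernel 0 w z)
        have h2 := Real.circleAverage_fun_smul (a := ε) (c := (0 : ℂ)) (R := 1)
          (f := poissonKernel 0 w)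
        simp only [smul_eq_mul] at h1 h2
        have h3 := Real.circleAverage_fun_add (c := (0 : ℂ)) (R := 1)
          (f₁ := fun z => poissonKernel 0 w z * ‖F z‖ ^ p) (f₂ := fun z => ε * poissonKernel 0 w z)
          (circleIntegrable_of_continuousOn (hP.mul hFp))
          (circleIntegrable_of_continuousOn (continuousOn_const.mul hP))
        rw [h1, h3, h2, circleAverage_poissonKernel hw, mul_one]
  have hlim : Filter.Tendsto (fun ε : ℝ => Real.exp (2 * ε) * (A + ε)) (nhdsWithin 0 (Ioi 0))
      (nhds (Real.exp (2 * 0) * (A + 0))) := by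
    apply tendsto_nhdsWithin_of_tendsto_nhds
    exact Continuous.tendsto (by fun_prop) 0
  have := ge_of_tendsto hlim (eventually_nhdsWithin_of_forall key)
  simpa using this

/-! ### The localising kernel on the circle -/

/-- A majorant of the Poisson kernel with a slower decay. -/
noncomputable def locKernel (ε δ v : ℝ) : ℝ := δ ^ ε / (δ + v) ^ (1 + ε)

lemma locKernel_nonneg {ε δ v : ℝ} (hδ : 0 < δ) (hv : 0 ≤ v) : 0 ≤ locKernel ε δ v := by
  unfold locKernel; positivity

lemma locKernel_anti {ε δ u v : ℝ} (hε : 0 < ε) (hδ : 0 < δ) (hu : 0 ≤ u) (huv : u ≤ v) :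
    locKernel ε δ v ≤ locKernel ε δ u := by
  unfold locKernel; gcongr

lemma continuousOn_locKernel {ε δ c : ℝ} (hδ : 0 < δ) (hc : 0 < c) :
    ContinuousOn (fun x => locKernel ε δ (c * x)) (Ici 0) := by
  unfold locKernel
  refine continuousOn_const.div (ContinuousOn.rpow_const (by fun_prop) fun x hx => .inl ?_)
    fun x hx => ?_ <;>
  · have hx0 : 0 ≤ x := hx
    positivity

lemma integral_locKernel_le {ε δ c L : ℝ} (hε : 0 < ε) (hδ : 0 < δ) (hc : 0 < c) (hL : 0 ≤ L) :
    ∫ x in (0 : ℝ)..L, locKernel ε δ (c * x) ≤ 1 / (c * ε) := by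
  have hder : ∀ x ∈ uIcc 0 L, HasDerivAt (fun x => -(δ ^ ε / (c * ε)) * (δ + c * x) ^ (-ε))
      (locKernel ε δ (c * x)) x := by
    intro x hx
    rw [uIcc_of_le hL] at hx
    have h0 : 0 < δ + c * x := by nlinarith [hx.1, mul_nonneg hc.le hx.1]
    have h1 : HasDerivAt (fun x => δ + c * x) c x := by
      simpa using ((hasDerivAt_id x).const_mul c).const_add δ
    have h2 := (h1.rpow_const (p := -ε) (.inl h0.ne')).const_mul (-(δ ^ ε / (c * ε)))
    refine h2.congr_deriv ?_
    rw [show -ε - 1 = -(1 + ε) by ring, Real.rpow_neg h0.le]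
    unfold locKernel
    field_simp
  have hcont : ContinuousOn (fun x => locKernel ε δ (c * x)) (uIcc 0 L) :=
    (continuousOn_locKernel hδ hc).mono (by rw [uIcc_of_le hL]; exact Icc_subset_Ici_self)
  rw [intervalIntegral.integral_eq_sub_of_hasDerivAt hder hcont.intervalIntegrable, mul_zero,
    add_zero]
  have h3 : δ ^ ε * δ ^ (-ε) = 1 := by rw [← Real.rpow_add hδ]; simp
  have h4 : 0 ≤ δ ^ ε / (c * ε) * (δ + c * L) ^ (-ε) := by positivity
  have h5 : δ ^ ε / (c * ε) * δ ^ (-ε) = 1 / (c * ε) := by rw [← h3]; ring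
  linarith

/-- The chord has length 2 sin(θ/2), and Jordan's inequality applies. -/
lemma norm_circleMap_sub_ge {θ : ℝ} (h0 : 0 ≤ θ) (h1 : θ ≤ Real.pi) (α : ℝ) :
    2 / Real.pi * θ ≤ ‖circleMap 0 1 (θ + α) - circleMap 0 1 α‖ := by
  have h2 : circleMap 0 1 (θ + α) - circleMap 0 1 α =
      circleMap 0 1 α * (Complex.exp (Complex.I * θ) - 1) := by
    simp only [circleMap, Complex.ofReal_one, one_mul, zero_add]
    rw [mul_sub, ← Complex.exp_add]
    push_cast
    ring_nf
  have h3 := Real.mul_le_sin (by linarith : 0 ≤ θ / 2) (by linarith)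
  rw [h2, norm_mul, Complex.norm_exp_I_mul_ofReal_sub_one, norm_circleMap_zero, abs_one, one_mul,
    Real.norm_eq_abs]
  refine le_trans ?_ (le_abs_self _)
  linarith

lemma continuous_locKernel_norm_sub {X : Type*} [TopologicalSpace X] {f g : X → ℂ} {ε δ : ℝ}
    (hδ : 0 < δ) (hf : Continuous f) (hg : Continuous g) :
    Continuous fun x => locKernel ε δ ‖f x - g x‖ := by
  unfold locKernel
  refine continuous_const.div (Continuous.rpow_const (by fun_prop) fun x => .inl ?_) fun x => ?_ <;>
  positivity

lemma locKernel_circleMap_le {ε δ : ℝ} (hε : 0 < ε) (hδ : 0 < δ) (α : ℝ) {θ : ℝ}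
    (hθ : θ ∈ Icc 0 (2 * Real.pi)) :
    locKernel ε δ ‖circleMap 0 1 (θ + α) - circleMap 0 1 α‖ ≤
      locKernel ε δ (2 / Real.pi * θ) + locKernel ε δ (2 / Real.pi * (2 * Real.pi - θ)) := by
  have hπ : 0 ≤ 2 / Real.pi := div_nonneg zero_le_two Real.pi_pos.le
  have h0 : 0 ≤ 2 / Real.pi * θ := mul_nonneg hπ hθ.1
  have h0' : 0 ≤ 2 / Real.pi * (2 * Real.pi - θ) := mul_nonneg hπ (by linarith [hθ.2])
  rcases le_total θ Real.pi with h | h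
  · have h1 := locKernel_anti hε hδ h0 (norm_circleMap_sub_ge hθ.1 h α)
    have h2 := locKernel_nonneg (ε := ε) hδ h0'
    linarith
  · have h1 := norm_circleMap_sub_ge (by linarith [hθ.2] : 0 ≤ 2 * Real.pi - θ) (by linarith)
      (θ + α - 2 * Real.pi)
    rw [show 2 * Real.pi - θ + (θ + α - 2 * Real.pi) = α by ring,
      norm_sub_rev, Function.Periodic.sub_eq (periodic_circleMap 0 1)] at h1
    have h2 := locKernel_anti hε hδ h0' h1
    have h3 := locKernel_nonneg (ε := ε) hδ h0
    linarith

lemma integral_locKernel_circleMap_le {ε δ : ℝ} (hε : 0 < ε) (hδ : 0 < δ) (α : ℝ) :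
    ∫ θ in (0 : ℝ)..2 * Real.pi, locKernel ε δ ‖circleMap 0 1 (θ + α) - circleMap 0 1 α‖ ≤
      2 * (1 / (2 / Real.pi * ε)) := by
  have hπ : 0 < 2 / Real.pi := div_pos zero_lt_two Real.pi_pos
  have h2π : (0 : ℝ) ≤ 2 * Real.pi := Real.two_pi_pos.le
  set g : ℝ → ℝ := fun θ => locKernel ε δ (2 / Real.pi * θ) with hgdef
  have hg : ContinuousOn g (Icc 0 (2 * Real.pi)) :=
    (continuousOn_locKernel hδ hπ).mono Icc_subset_Ici_self
  have hg' : ContinuousOn (fun θ => g (2 * Real.pi - θ)) (Icc 0 (2 * Real.pi)) :=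
    hg.comp (by fun_prop) fun θ hθ => ⟨by linarith [hθ.2], by linarith [hθ.1]⟩
  have hgi : IntervalIntegrable g volume 0 (2 * Real.pi) :=
    ContinuousOn.intervalIntegrable_of_Icc h2π hg
  have hgi' : IntervalIntegrable (fun θ => g (2 * Real.pi - θ)) volume 0 (2 * Real.pi) :=
    ContinuousOn.intervalIntegrable_of_Icc h2π hg'
  have hcont : Continuous fun θ => locKernel ε δ ‖circleMap 0 1 (θ + α) - circleMap 0 1 α‖ :=
    continuous_locKernel_norm_sub hδ (by fun_prop) continuous_const
  have hmono := intervalIntegral.integral_mono_on h2π (hcont.intervalIntegrable _ _)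
    (hgi.add hgi') fun θ hθ => locKernel_circleMap_le hε hδ α hθ
  have hint := integral_locKernel_le (c := 2 / Real.pi) hε hδ hπ h2π
  have hadd := intervalIntegral.integral_add hgi hgi'
  rw [intervalIntegral.integral_comp_sub_left g, sub_self, sub_zero] at hadd
  refine hmono.trans ?_
  refine hadd.le.trans ?_
  linarith

lemma circleAverage_locKernel_le {ε : ℝ} (hε : 0 < ε) :
    ∃ C : ℝ, 0 < C ∧ ∀ δ : ℝ, 0 < δ → ∀ w : ℂ, ‖w‖ = 1 →
      Real.circleAverage (fun z => locKernel ε δ ‖z - w‖) 0 1 ≤ C := by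
  have hπ := Real.pi_pos
  refine ⟨(2 * Real.pi)⁻¹ * (2 * (1 / (2 / Real.pi * ε))), by positivity, fun δ hδ w hw => ?_⟩
  have hexp : circleMap 0 1 w.arg = w := by
    simpa [hw, circleMap] using Complex.norm_mul_exp_arg_mul_I w
  have h := integral_locKernel_circleMap_le hε hδ w.arg
  rw [hexp] at h
  rw [Real.circleAverage_eq_integral_add w.arg, smul_eq_mul]
  gcongr

lemma circleAverage_const_mul (a : ℝ) (f : ℂ → ℝ) (c : ℂ) (R : ℝ) :
    Real.circleAverage (fun z => a * f z) c R = a * Real.circleAverage f c R :=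
  Real.circleAverage_fun_smul (a := a) (f := f)

lemma norm_sub_mul_comm {w z : ℂ} (hw : ‖w‖ = 1) (hz : ‖z‖ = 1) (s : ℝ) :
    ‖w - s * z‖ = ‖z - s * w‖ := by
  have h1 : ‖w - s * z‖ ^ 2 = ‖z - s * w‖ ^ 2 := by
    rw [← Complex.normSq_eq_norm_sq, ← Complex.normSq_eq_norm_sq, Complex.normSq_sub,
      Complex.normSq_sub]
    simp only [Complex.normSq_eq_norm_sq, hw, hz, map_mul, Complex.mul_re,
      Complex.mul_im, Complex.conj_re, Complex.conj_im, Complex.conj_ofReal, Complex.ofReal_re,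
      Complex.ofReal_im]
    ring
  exact (pow_left_inj₀ (norm_nonneg _) (norm_nonneg _) two_ne_zero).1 h1

lemma one_sub_le_norm_sub {w z : ℂ} (hw : ‖w‖ = 1) (hz : ‖z‖ = 1) {s : ℝ} (hs : 0 ≤ s) :
    1 - s ≤ ‖w - s * z‖ := by
  have := norm_sub_norm_le w (s * z)
  simpa [hw, hz, abs_of_nonneg hs] using this

/-- Recentring: with D = |z-sw|, E = |η-sz|, v = |η-w|, the bounds 1-s ≤ D, 1-s ≤ E and v ≤ D+E give
(1-s)(1-s+v) ≤ 3DE, at the price (D/(1-s))². Rescaling: lowering the decay exponent from 2 to 1+ε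
makes the passage from scale 1-s to δ cost only ((1-s)/δ)^ε. The fixed scale δ lets one average
serve all radii. -/
lemma poissonKernel_le {w z η : ℂ} (hw : ‖w‖ = 1) (hz : ‖z‖ = 1) (hη : ‖η‖ = 1) {s δ ε : ℝ}
    (hs0 : 0 ≤ s) (hs : s < 1) (hδ : 0 < δ) (hδs : δ ≤ 2 * (1 - s)) (hε : 0 < ε) (hε1 : ε ≤ 1) :
    poissonKernel 0 (s * z) η ≤ 72 * ((1 - s) / δ) ^ ε * (‖z - s * w‖ / (1 - s)) ^ 2 *
      locKernel ε δ ‖η - w‖ := by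
  have hsz : ‖(s : ℂ) * z‖ = s := by simp [hz, abs_of_nonneg hs0]
  rw [poissonKernel_zero _ _ hη, hsz]
  set σ := 1 - s with hσ
  have hσ0 : 0 < σ := by linarith
  set D := ‖z - s * w‖
  set E := ‖η - s * z‖
  set v := ‖η - w‖
  have hD : σ ≤ D := one_sub_le_norm_sub hz hw hs0
  have hE : σ ≤ E := one_sub_le_norm_sub hη hz hs0
  have hv0 : 0 ≤ v := norm_nonneg _
  have hD0 : 0 < D := by linarith
  have hE0 : 0 < E := by linarith
  have hv : v ≤ D + E := by
    have h1 : ‖w - s * z‖ = D := norm_sub_mul_comm hw hz s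
    have h2 := norm_sub_le_norm_sub_add_norm_sub η (s * z) w
    rw [norm_sub_rev (s * z : ℂ) w, h1] at h2
    linarith
  have hX : σ * (σ + v) ≤ 3 * (D * E) := by nlinarith
  have hP : (1 - s ^ 2) / E ^ 2 ≤ 18 * (D / σ) ^ 2 * (σ / (σ + v) ^ 2) := by
    have h1 : 1 - s ^ 2 ≤ 2 * σ := by rw [hσ]; nlinarith
    rw [div_le_iff₀ (by positivity)]
    refine h1.trans ?_
    have h3 : 18 * (D / σ) ^ 2 * (σ / (σ + v) ^ 2) * E ^ 2 =
        2 * σ * (3 * (D * E) / (σ * (σ + v))) ^ 2 := by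
      field_simp; ring
    rw [h3]
    have h4 : 1 ≤ 3 * (D * E) / (σ * (σ + v)) := by
      rw [le_div_iff₀ (by positivity)]; linarith
    exact le_mul_of_one_le_right (by positivity) (one_le_pow₀ h4)
  have hQ : σ / (σ + v) ^ 2 ≤ 4 * ((σ / δ) ^ ε * locKernel ε δ v) := by
    have h1 : (σ / δ) ^ ε * locKernel ε δ v = σ ^ ε / (δ + v) ^ (1 + ε) := by
      rw [locKernel, Real.div_rpow hσ0.le hδ.le]
      field_simp
    have h2 : σ = σ ^ ε * σ ^ (1 - ε) := by rw [← Real.rpow_add hσ0]; simp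
    have h3 : (σ + v) ^ 2 = (σ + v) ^ (1 + ε) * (σ + v) ^ (1 - ε) := by
      rw [← Real.rpow_add (by positivity), ← Real.rpow_natCast]; congr 1; push_cast; ring
    have h4 : σ ^ (1 - ε) ≤ (σ + v) ^ (1 - ε) :=
      Real.rpow_le_rpow hσ0.le (by linarith) (by linarith)
    have h5 : (δ + v) ^ (1 + ε) ≤ 4 * (σ + v) ^ (1 + ε) := by
      calc (δ + v) ^ (1 + ε) ≤ (2 * (σ + v)) ^ (1 + ε) := by gcongr; linarith
        _ = 2 ^ (1 + ε) * (σ + v) ^ (1 + ε) := Real.mul_rpow (by norm_num) (by positivity)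
        _ ≤ 2 ^ (2 : ℝ) * (σ + v) ^ (1 + ε) := by
          gcongr
          · norm_num
          · linarith
        _ = _ := by norm_num
    rw [h1, h3, ← mul_div_assoc, div_le_div_iff₀ (by positivity) (by positivity)]
    calc σ * (δ + v) ^ (1 + ε) = σ ^ ε * σ ^ (1 - ε) * (δ + v) ^ (1 + ε) := by rw [← h2]
      _ ≤ σ ^ ε * (σ + v) ^ (1 - ε) * (4 * (σ + v) ^ (1 + ε)) := by gcongr
      _ = _ := by ring
  calc _ ≤ _ := hP
    _ ≤ 18 * (D / σ) ^ 2 * (4 * ((σ / δ) ^ ε * locKernel ε δ v)) := by gcongr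
    _ = _ := by ring

/-- Since |z-sw| is at least a third of (1-s)+|z-w|, this is the localising kernel with ε = 1 and δ
= 1-s, up to a factor 9/(1-s). -/
lemma circleAverage_inv_sq_le :
    ∃ C : ℝ, 0 < C ∧ ∀ (w : ℂ) (s : ℝ), ‖w‖ = 1 → 0 ≤ s → s < 1 →
      Real.circleAverage (fun z => (‖z - s * w‖ ^ 2)⁻¹) 0 1 ≤ C / (1 - s) := by
  obtain ⟨C, hC, h⟩ := circleAverage_locKernel_le one_pos
  refine ⟨9 * C, by positivity, fun w s hw hs0 hs => ?_⟩
  have hσ : 0 < 1 - s := by linarith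
  have hpos (z : ℂ) (hz : ‖z‖ = 1) : 0 < ‖z - s * w‖ :=
    hσ.trans_le (one_sub_le_norm_sub hz hw hs0)
  have hle : ∀ z ∈ sphere (0 : ℂ) |1|,
      (‖z - s * w‖ ^ 2)⁻¹ ≤ (9 / (1 - s)) * locKernel 1 (1 - s) ‖z - w‖ := by
    intro z hz
    have hz1 : ‖z‖ = 1 := by simpa using hz
    have h0 := hpos z hz1
    have h1 : ‖z - w‖ ≤ 2 * ‖z - s * w‖ := by
      have h2 := norm_sub_le_norm_sub_add_norm_sub z (s * w) w
      have h3 : ‖(s : ℂ) * w - w‖ = 1 - s := by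
        rw [show (s : ℂ) * w - w = ((s - 1 : ℝ) : ℂ) * w by push_cast; ring, norm_mul, hw,
          mul_one, Complex.norm_real, Real.norm_eq_abs, abs_of_neg (by linarith)]
        ring
      linarith [one_sub_le_norm_sub hz1 hw hs0]
    have h4 : (1 - s) + ‖z - w‖ ≤ 3 * ‖z - s * w‖ := by
      linarith [one_sub_le_norm_sub hz1 hw hs0]
    rw [locKernel, Real.rpow_one, show (1 : ℝ) + 1 = (2 : ℕ) by norm_num, Real.rpow_natCast,
      div_mul_div_comm, mul_comm (9 : ℝ), mul_div_mul_left _ _ hσ.ne',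
      inv_le_comm₀ (by positivity) (by positivity), inv_div, div_le_iff₀ (by norm_num)]
    calc _ ≤ (3 * ‖z - s * w‖) ^ 2 := by gcongr
      _ = _ := by ring
  have hc1 : ContinuousOn (fun z => (‖z - s * w‖ ^ 2)⁻¹) (sphere 0 1) := by
    refine ContinuousOn.inv₀ (by fun_prop) fun z hz => ?_
    have := hpos z (by simpa using hz)
    positivity
  have hc2 : Continuous fun z => (9 / (1 - s)) * locKernel 1 (1 - s) ‖z - w‖ :=
    continuous_const.mul (continuous_locKernel_norm_sub hσ continuous_id continuous_const)
  refine (Real.circleAverage_mono (circleIntegrable_of_continuousOn hc1)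
    (circleIntegrable_of_continuousOn hc2.continuousOn) hle).trans ?_
  rw [circleAverage_const_mul]
  calc _ ≤ 9 / (1 - s) * C := by gcongr; exact h _ hσ w hw
    _ = _ := by ring

/-- The average of `‖F‖ ^ p` over the unit circle against the kernel `locKernel` centred at `w`. -/
noncomputable def locAverage (ε δ p : ℝ) (F : ℂ → ℂ) (w : ℂ) : ℝ :=
  Real.circleAverage (fun η => locKernel ε δ ‖η - w‖ * ‖F η‖ ^ p) 0 1

lemma locAverage_nonneg {ε δ : ℝ} (hδ : 0 < δ) (p : ℝ) (F : ℂ → ℂ) (w : ℂ) :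
    0 ≤ locAverage ε δ p F w :=
  Real.circleAverage_nonneg_of_nonneg fun _ _ =>
    mul_nonneg (locKernel_nonneg hδ (norm_nonneg _)) (by positivity)

lemma norm_rpow_le_locAverage {F : ℂ → ℂ} (hF : DiffContOnCl ℂ F (ball 0 1)) {p : ℝ} (hp : 0 < p)
    {w z : ℂ} (hw : ‖w‖ = 1) (hz : ‖z‖ = 1) {s δ ε : ℝ}
    (hs0 : 0 ≤ s) (hs : s < 1) (hδ : 0 < δ) (hδs : δ ≤ 2 * (1 - s)) (hε : 0 < ε) (hε1 : ε ≤ 1) :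
    ‖F (s * z)‖ ^ p ≤ 72 * ((1 - s) / δ) ^ ε * (‖z - s * w‖ / (1 - s)) ^ 2 *
      locAverage ε δ p F w := by
  have hsz : ‖(s : ℂ) * z‖ < 1 := by simpa [hz, abs_of_nonneg hs0] using hs
  have hFc : ContinuousOn (fun z => ‖F z‖ ^ p) (sphere 0 1) :=
    (hF.continuousOn.mono (by rw [closure_ball _ one_ne_zero]; exact
      sphere_subset_closedBall)).norm.rpow_const fun _ _ => .inr hp.le
  have hK : Continuous fun η => locKernel ε δ ‖η - w‖ :=
    continuous_locKernel_norm_sub hδ continuous_id continuous_const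
  refine (norm_rpow_le_poisson hF hp hsz).trans ?_
  rw [locAverage, ← circleAverage_const_mul]
  refine Real.circleAverage_mono
    (circleIntegrable_of_continuousOn ((continuousOn_poissonKernel hsz).mul hFc))
    (circleIntegrable_of_continuousOn (continuousOn_const.mul (hK.continuousOn.mul hFc))) fun η hη => ?_
  have hη1 : ‖η‖ = 1 := by simpa using hη
  rw [← mul_assoc]
  exact mul_le_mul_of_nonneg_right (poissonKernel_le hw hz hη1 hs0 hs hδ hδs hε hε1)
    (by positivity)

/-! ### Circular convolution and fractional integration -/

lemma hasSum_intervalIntegral_of_bound {E : Type*} [NormedAddCommGroup E] [NormedSpace ℝ E]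
    {g : ℕ → ℝ → E} {G : ℝ → E} {b : ℕ → ℝ} {α β : ℝ} (hαβ : α ≤ β) (hb : Summable b)
    (hg : ∀ n, ContinuousOn (g n) (Icc α β)) (hgb : ∀ n, ∀ x ∈ Icc α β, ‖g n x‖ ≤ b n)
    (hG : ∀ x ∈ Icc α β, HasSum (fun n => g n x) (G x)) :
    HasSum (fun n => ∫ x in α..β, g n x) (∫ x in α..β, G x) := by
  have hsub : uIoc α β ⊆ Icc α β := by rw [uIoc_of_le hαβ]; exact Ioc_subset_Icc_self
  refine intervalIntegral.hasSum_integral_of_dominated_convergence (fun n _ => b n)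
    (fun n => ((hg n).mono hsub).aestronglyMeasurable measurableSet_uIoc)
    (fun n => .of_forall fun x hx => hgb n x (hsub hx)) (.of_forall fun _ _ => hb)
    intervalIntegrable_const (.of_forall fun x hx => hG x (hsub hx))

lemma hasSum_circleAverage {g : ℕ → ℂ → ℂ} {G : ℂ → ℂ} {b : ℕ → ℝ} (hb : Summable b)
    (hg : ∀ n, ContinuousOn (g n) (sphere 0 1)) (hgb : ∀ n, ∀ z ∈ sphere (0 : ℂ) 1, ‖g n z‖ ≤ b n)
    (hG : ∀ z ∈ sphere (0 : ℂ) 1, HasSum (fun n => g n z) (G z)) :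
    HasSum (fun n => Real.circleAverage (g n) 0 1) (Real.circleAverage G 0 1) := by
  have hmem (θ : ℝ) : circleMap 0 1 θ ∈ sphere (0 : ℂ) 1 := circleMap_mem_sphere _ zero_le_one _
  have := hasSum_intervalIntegral_of_bound (g := fun n θ => g n (circleMap 0 1 θ))
    (G := fun θ => G (circleMap 0 1 θ)) Real.two_pi_pos.le hb
    (fun n => ((hg n).comp_continuous (continuous_circleMap 0 1) hmem).continuousOn)
    (fun n θ _ => hgb n _ (hmem θ)) (fun θ _ => hG _ (hmem θ))
  exact this.const_smul _

lemma circleAverage_pow_mul_inv_pow (m n : ℕ) :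
    Real.circleAverage (fun z : ℂ => z ^ m * z⁻¹ ^ n) 0 1 = if m = n then 1 else 0 := by
  split_ifs with h
  · subst h
    refine Real.circleAverage_const_on_circle fun z hz => ?_
    have hz0 : z ≠ 0 := by
      rintro rfl
      simp at hz
    rw [← mul_pow, mul_inv_cancel₀ hz0, one_pow]
  · rw [Real.circleAverage_eq_circleIntegral one_ne_zero]
    have h1 : (∮ z in C(0, 1), (z - 0)⁻¹ • (z ^ m * z⁻¹ ^ n)) =
        ∮ z in C(0, 1), (z - 0) ^ ((m : ℤ) - n - 1) := by
      refine circleIntegral.integral_congr zero_le_one fun z hz => ?_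
      have hz0 : z ≠ 0 := by
        rintro rfl
        simp at hz
      simp only [sub_zero, smul_eq_mul]
      rw [zpow_sub₀ hz0, zpow_sub₀ hz0, zpow_natCast, zpow_natCast, zpow_one, inv_pow]
      field_simp
    rw [h1, circleIntegral.integral_sub_zpow_of_ne (by omega), smul_zero]

lemma norm_le_of_hasSum {φ : ℕ → ℂ} {F : ℂ → ℂ} {B : ℝ}
    (hF : ∀ z : ℂ, ‖z‖ < 1 → HasSum (fun n => φ n * z ^ n) (F z)) (hφ : ∀ n, ‖φ n‖ ≤ B)
    {z : ℂ} (hz : ‖z‖ < 1) : ‖F z‖ ≤ B * (1 - ‖z‖)⁻¹ := by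
  refine (hF z hz).norm_le_of_bounded
    ((hasSum_geometric_of_lt_one (norm_nonneg z) hz).mul_left B) fun n => ?_
  rw [norm_mul, norm_pow]
  gcongr
  exact hφ n

lemma continuousOn_inv_sphere : ContinuousOn (fun z : ℂ => z⁻¹) (sphere 0 1) :=
  continuousOn_id.inv₀ fun z hz h => by
    rw [id_eq] at h
    subst h
    simp at hz

lemma circleAverage_mul_inv_pow {φ : ℕ → ℂ} {F : ℂ → ℂ} {B : ℝ}
    (hF : ∀ z : ℂ, ‖z‖ < 1 → HasSum (fun n => φ n * z ^ n) (F z)) (hφ : ∀ n, ‖φ n‖ ≤ B)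
    {s : ℝ} (hs0 : 0 ≤ s) (hs : s < 1) (n : ℕ) :
    Real.circleAverage (fun z : ℂ => F (s * z) * z⁻¹ ^ n) 0 1 = φ n * (s : ℂ) ^ n := by
  have h1 : HasSum (fun m => Real.circleAverage
      (fun z : ℂ => (φ m * (s : ℂ) ^ m) • (z ^ m * z⁻¹ ^ n)) 0 1)
      (Real.circleAverage (fun z : ℂ => F (s * z) * z⁻¹ ^ n) 0 1) := by
    refine hasSum_circleAverage (b := fun m => B * s ^ m)
      ((summable_geometric_of_lt_one hs0 hs).mul_left B) (fun m => ?_) (fun m z hz => ?_)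
      fun z hz => ?_
    · have h2 : ContinuousOn (fun z : ℂ => z ^ m * z⁻¹ ^ n) (sphere 0 1) :=
        (continuousOn_pow m).mul (continuousOn_inv_sphere.pow n)
      have h3 : ContinuousOn (fun z : ℂ => (φ m * (s : ℂ) ^ m) * (z ^ m * z⁻¹ ^ n)) (sphere 0 1) :=
        continuousOn_const.mul h2
      exact h3
    · have hz1 : ‖z‖ = 1 := by simpa using hz
      rw [smul_eq_mul, norm_mul, norm_mul, norm_mul, norm_pow, norm_pow, norm_pow, norm_inv, hz1,
        Complex.norm_real, Real.norm_of_nonneg hs0]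
      simp only [inv_one, one_pow, mul_one]
      gcongr
      exact hφ m
    · have hz1 : ‖z‖ = 1 := by simpa using hz
      have h2 := (hF (s * z) (by simpa [hz1, abs_of_nonneg hs0] using hs)).mul_right (z⁻¹ ^ n)
      refine (congrArg (fun f => HasSum f _) (funext fun m => ?_)).mp h2
      rw [smul_eq_mul, mul_pow]; ring
  simp only [Real.circleAverage_fun_smul, circleAverage_pow_mul_inv_pow] at h1
  refine h1.unique ?_
  convert hasSum_ite_eq n (φ n * (s : ℂ) ^ n) using 1
  ext m
  split_ifs with h
  · subst h; simp
  · simp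

/-- Orthogonality of powers on the circle, where z⁻¹ is the conjugate of z. The radius s² is split
evenly, so that F and the kernel series are both evaluated at radius s < 1. -/
lemma hasSum_convolution {c : ℕ → ℝ} (hc : PolyBdd c) {φ : ℕ → ℂ} {F : ℂ → ℂ} {B : ℝ}
    (hF : ∀ z : ℂ, ‖z‖ < 1 → HasSum (fun n => φ n * z ^ n) (F z)) (hφ : ∀ n, ‖φ n‖ ≤ B)
    (hFc : ContinuousOn F (ball 0 1)) {s : ℝ} (hs0 : 0 ≤ s) (hs : s < 1) {w : ℂ} (hw : ‖w‖ = 1) :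
    HasSum (fun n => (c n : ℂ) * φ n * ((s ^ 2 : ℝ) * w : ℂ) ^ n)
      (Real.circleAverage (fun z => F (s * z) * ∑' n, (c n : ℂ) * (s * w * z⁻¹) ^ n) 0 1) := by
  have hx {z : ℂ} (hz : ‖z‖ = 1) : ‖(s : ℂ) * w * z⁻¹‖ = s := by
    simp [hw, hz, abs_of_nonneg hs0]
  have hsz {z : ℂ} (hz : ‖z‖ = 1) : ‖(s : ℂ) * z‖ = s := by simp [hz, abs_of_nonneg hs0]
  have h1 : HasSum (fun n => Real.circleAverage
      (fun z : ℂ => ((c n : ℂ) * (s * w) ^ n) • (F (s * z) * z⁻¹ ^ n)) 0 1)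
      (Real.circleAverage (fun z => F (s * z) * ∑' n, (c n : ℂ) * (s * w * z⁻¹) ^ n) 0 1) := by
    refine hasSum_circleAverage (b := fun n => |c n| * s ^ n * (B * (1 - s)⁻¹))
      ((hc.summable hs0 hs).mul_right _) (fun n => ?_) (fun n z hz => ?_) fun z hz => ?_
    · have h2 : ContinuousOn (fun z : ℂ => F (s * z)) (sphere 0 1) :=
        hFc.comp (by fun_prop) fun z hz => by
          rw [mem_ball_zero_iff, hsz (by simpa using hz)]
          exact hs
      have h3 : ContinuousOn (fun z : ℂ => F (s * z) * z⁻¹ ^ n) (sphere 0 1) :=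
        h2.mul (continuousOn_inv_sphere.pow n)
      have h4 : ContinuousOn (fun z : ℂ => ((c n : ℂ) * (s * w) ^ n) * (F (s * z) * z⁻¹ ^ n))
        (sphere 0 1) := continuousOn_const.mul h3
      exact h4
    · have hz1 : ‖z‖ = 1 := by simpa using hz
      have h2 := norm_le_of_hasSum hF hφ (z := s * z) (by rw [hsz hz1]; exact hs)
      rw [hsz hz1] at h2
      rw [smul_eq_mul, norm_mul, norm_mul, norm_mul, norm_pow, norm_pow, norm_inv, norm_mul, hz1,
        hw, Complex.norm_real, Complex.norm_real, Real.norm_eq_abs, Real.norm_of_nonneg hs0]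
      simp only [inv_one, one_pow, mul_one]
      gcongr
    · have hz1 : ‖z‖ = 1 := by simpa using hz
      have h2 : Summable fun n => (c n : ℂ) * (s * w * z⁻¹) ^ n :=
        (hc.summable_norm (by rw [hx hz1]; exact hs)).of_norm
      refine (congrArg (fun f => HasSum f _) (funext fun n => ?_)).mp
        (h2.hasSum.mul_left (F (s * z)))
      rw [smul_eq_mul, mul_pow (_ * w)]
      ring
  convert h1 using 1
  ext n
  rw [Real.circleAverage_fun_smul, circleAverage_mul_inv_pow hF hφ hs0 hs, smul_eq_mul]
  push_cast
  ring

lemma integral_pow_mul_one_sub_pow (n N : ℕ) :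
    ∫ x in (0 : ℝ)..1, (x : ℂ) ^ n * (1 - x) ^ N =
      (N.factorial : ℂ) / ((n + 1).ascFactorial (N + 1) : ℂ) := by
  have h := Complex.betaIntegral_eval_nat_add_one_right (u := (n : ℂ) + 1)
    (by simp; positivity) N
  rw [Nat.ascFactorial_eq_prod_range]
  push_cast
  rw [← h, Complex.betaIntegral]
  simp only [add_sub_cancel_right, Complex.cpow_natCast]

/-- Recovering the multiplier `1 / μ_{2n+1}` from `kernelCoeff` by a fractional integral. -/
lemma factorial_mul_tsum_eq {μ : ℝ → ℝ} (hμ : IsDHat μ) (N : ℕ) {φ : ℕ → ℂ} {B : ℝ}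
    (hφ : ∀ n, ‖φ n‖ ≤ B) {t : ℝ} (ht0 : 0 ≤ t) (ht : t < 1) {w : ℂ} (hw : ‖w‖ = 1) :
    (N.factorial : ℂ) * ∑' n, (((diffMoment μ 0 n)⁻¹ : ℝ) : ℂ) * φ n * (t * w) ^ n =
      ∫ x in (0 : ℝ)..1, (1 - x : ℂ) ^ N *
        ∑' n, (kernelCoeff μ (N + 1) n : ℂ) * φ n * ((t * x : ℝ) * w) ^ n := by
  have hB : 0 ≤ B := (norm_nonneg _).trans (hφ 0)
  have hc := hμ.polyBdd_kernelCoeff (N + 1)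
  have hnorm (n : ℕ) (x : ℝ) (hx : x ∈ Icc (0 : ℝ) 1) :
      ‖(kernelCoeff μ (N + 1) n : ℂ) * φ n * ((t * x : ℝ) * w) ^ n‖ ≤
        |kernelCoeff μ (N + 1) n| * t ^ n * B := by
    have htx : 0 ≤ t * x := mul_nonneg ht0 hx.1
    rw [norm_mul, norm_mul, norm_pow, norm_mul, hw, Complex.norm_real, Complex.norm_real,
      Real.norm_eq_abs, Real.norm_of_nonneg htx, mul_one, mul_right_comm]
    gcongr
    · exact mul_le_of_le_one_right ht0 hx.2
    · exact hφ n
  have hb := (hc.summable ht0 ht).mul_right B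
  have h1 : HasSum (fun n => ∫ x in (0 : ℝ)..1, (1 - x : ℂ) ^ N *
      ((kernelCoeff μ (N + 1) n : ℂ) * φ n * ((t * x : ℝ) * w) ^ n))
      (∫ x in (0 : ℝ)..1, (1 - x : ℂ) ^ N *
        ∑' n, (kernelCoeff μ (N + 1) n : ℂ) * φ n * ((t * x : ℝ) * w) ^ n) := by
    refine hasSum_intervalIntegral_of_bound zero_le_one hb (fun n => ?_) (fun n x hx => ?_)
      fun x hx => ?_
    · fun_prop
    · rw [norm_mul, norm_pow]
      have h2 : ‖(1 - x : ℂ)‖ ≤ 1 := by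
        rw [show (1 - x : ℂ) = ((1 - x : ℝ) : ℂ) by push_cast; ring, Complex.norm_real,
          Real.norm_of_nonneg (by linarith [hx.2])]
        linarith [hx.1]
      exact (mul_le_of_le_one_left (norm_nonneg _) (pow_le_one₀ (norm_nonneg _) h2)).trans
        (hnorm n x hx)
    · exact (Summable.hasSum (.of_norm_bounded hb fun n => hnorm n x hx)).mul_left _
  rw [← h1.tsum_eq, ← tsum_mul_left]
  congr 1
  ext n
  have h3 : (fun x : ℝ => (1 - x : ℂ) ^ N *
      ((kernelCoeff μ (N + 1) n : ℂ) * φ n * ((t * x : ℝ) * w) ^ n)) = fun x : ℝ =>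
      ((kernelCoeff μ (N + 1) n : ℂ) * φ n * (t * w) ^ n) * ((x : ℂ) ^ n * (1 - x) ^ N) := by
    ext x
    push_cast
    ring
  have h4 : ((n + 1).ascFactorial (N + 1) : ℂ) ≠ 0 := by
    exact_mod_cast (Nat.ascFactorial_pos n (N + 1)).ne'
  rw [h3, intervalIntegral.integral_const_mul, integral_pow_mul_one_sub_pow, kernelCoeff]
  push_cast
  field_simp

/-! ### Pointwise control by local averages -/

lemma IsD.exists_hat_const {μ : ℝ → ℝ} (hμ : IsD μ) :
    ∃ C : ℝ, 0 < C ∧ ∀ s : ℝ, 0 ≤ s → s < 1 → tail μ (s ^ 2) ≤ C * tail μ s := by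
  obtain ⟨hw, C, hC, h⟩ := hμ.1
  refine ⟨C, by linarith, fun s hs0 hs => ?_⟩
  refine (h (s ^ 2) ⟨by positivity, by nlinarith⟩).trans ?_
  gcongr
  exact tail_anti hw hs0 (by nlinarith [sq_nonneg (1 - s)])

lemma IsD.exists_check_const {μ : ℝ → ℝ} (hμ : IsD μ) {b : ℝ} (hb : 0 < b) :
    ∃ C β : ℝ, 0 < C ∧ 0 < β ∧ β ≤ b ∧ ∀ r t : ℝ, 0 ≤ r → r ≤ t → t < 1 →
      tail μ t * ((1 - r) / (1 - t)) ^ β ≤ C * tail μ r := by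
  obtain ⟨C, β, hC, hβ, h⟩ := hμ.2.tail_mul_rpow_le
  refine ⟨C, min β b, hC, lt_min hβ hb, min_le_right _ _, fun r t hr hrt ht => ?_⟩
  refine le_trans ?_ (h r t hr hrt ht)
  have := hμ.2.1.tail_pos t ⟨hr.trans hrt, ht⟩
  gcongr
  · rw [le_div_iff₀ (by linarith)]; linarith
  · exact min_le_left _ _

/-- The radial derivatives of `D^μ F` are controlled by local averages of `F`. -/
lemma IsD.norm_tsum_kernelCoeff_le {μ : ℝ → ℝ} (hμ : IsD μ) {p : ℝ} (hp : 0 < p) {m : ℕ}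
    (hm : 2 / p ≤ m) :
    ∃ C κ : ℝ, 0 < C ∧ 0 < κ ∧ κ * p ≤ 1 ∧ ∀ (F : ℂ → ℂ) (φ : ℕ → ℂ) (B : ℝ),
      DiffContOnCl ℂ F (ball 0 1) → (∀ z : ℂ, ‖z‖ < 1 → HasSum (fun n => φ n * z ^ n) (F z)) →
      (∀ n, ‖φ n‖ ≤ B) → ∀ t x : ℝ, 0 ≤ t → t < 1 → 0 ≤ x → x ≤ 1 → ∀ w : ℂ, ‖w‖ = 1 →
      ‖∑' n, (kernelCoeff μ (m + 2) n : ℂ) * φ n * ((t * x : ℝ) * w) ^ n‖ ≤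
        C * (locAverage (κ * p) (1 - t) p F w ^ (1 / p) / tail μ t) *
          (((1 - t) / (1 - t * x)) ^ κ / (1 - t * x) ^ (m + 2)) := by
  obtain ⟨C₀, hC₀, hhat⟩ := hμ.exists_hat_const
  -- Capping β at 2/p ensures that (β/2)p ≤ 1, as `poissonKernel_le` requires of its exponent.
  obtain ⟨C₁, β, hC₁, hβ, hβp, hcheck⟩ := hμ.exists_check_const (by positivity : 0 < 2 / p)
  obtain ⟨C₂, hC₂, hker⟩ := hμ.1.kernel_bound (m + 2)
  obtain ⟨C₃, hC₃, hsq⟩ := circleAverage_inv_sq_le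
  have hκp : β / 2 * p ≤ 1 := by
    rw [le_div_iff₀ hp] at hβp; linarith
  -- Reverse doubling gains the power β of (1-t)/(1-tx); changing the scale of the local average
  -- spends half of it, and κ = β/2 survives.
  refine ⟨72 ^ (1 / p) * C₂ * C₃ * (C₀ * C₁) * 2 ^ (m + 2), β / 2, by positivity, by positivity,
    hκp, fun F φ B hF hsum hφ t x ht0 ht hx0 hx w hw => ?_⟩
  have hw' := hμ.1.1
  set δ := 1 - t with hδdef
  have hδ : 0 < δ := by linarith
  set U := locAverage (β / 2 * p) δ p F w
  have hU : 0 ≤ U := locAverage_nonneg hδ p F w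
  set y := t * x with hydef
  have hy0 : 0 ≤ y := mul_nonneg ht0 hx0
  have hyt : y ≤ t := mul_le_of_le_one_right ht0 hx
  set s := √y with hsdef
  have hs0 : 0 ≤ s := Real.sqrt_nonneg y
  have hsy : s ^ 2 = y := Real.sq_sqrt hy0
  have hs1 : s < 1 := by
    rw [hsdef, Real.sqrt_lt' one_pos]; linarith
  set σ := 1 - s with hσdef
  have hσ : 0 < σ := by linarith
  have hσy : σ ≤ 1 - y := by nlinarith
  have hyσ : 1 - y ≤ 2 * σ := by nlinarith
  have h1y : 0 < 1 - y := by linarith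
  have hts : 0 < tail μ s := hw'.tail_pos s ⟨hs0, hs1⟩
  have htt : 0 < tail μ t := hw'.tail_pos t ⟨ht0, ht⟩
  have hFc : ContinuousOn F (closedBall 0 1) := by
    have := hF.continuousOn
    rwa [closure_ball _ one_ne_zero] at this
  have hconv := hasSum_convolution (hμ.1.polyBdd_kernelCoeff (m + 2)) hsum hφ
    (hFc.mono ball_subset_closedBall) hs0 hs1 hw
  rw [hsy] at hconv
  rw [hconv.tsum_eq]
  set A := 72 ^ (1 / p) * (σ / δ) ^ (β / 2) * U ^ (1 / p) * (C₂ / (σ ^ (m + 1) * tail μ s)) with hA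
  have hA0 : 0 ≤ A := by positivity
  have hpt (z : ℂ) (hz : ‖z‖ = 1) :
      ‖F (s * z)‖ * ‖kernel μ (m + 2) (s * w * z⁻¹)‖ ≤ A * (‖z - s * w‖ ^ 2)⁻¹ := by
    have hD : σ ≤ ‖z - s * w‖ := one_sub_le_norm_sub hz hw hs0
    set D := ‖z - s * w‖ with hDdef
    have hD0 : 0 < D := by linarith
    have hz0 : z ≠ 0 := by rintro rfl; simp at hz
    have hxn : ‖(s : ℂ) * w * z⁻¹‖ = s := by simp [hw, hz, abs_of_nonneg hs0]
    have hxd : ‖1 - (s : ℂ) * w * z⁻¹‖ = D := by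
      rw [show 1 - (s : ℂ) * w * z⁻¹ = (z - s * w) * z⁻¹ by field_simp, norm_mul, norm_inv, hz]
      simp [hDdef]
    have hK := hker (s * w * z⁻¹) (by rw [hxn]; exact hs1)
    rw [hxn, hxd] at hK
    have hloc := norm_rpow_le_locAverage hF hp hw hz hs0 hs1 hδ
      (by linarith : δ ≤ 2 * (1 - s)) (by positivity : 0 < β / 2 * p) hκp
    have hDσ : 1 ≤ D / σ := by rw [le_div_iff₀ hσ]; linarith
    -- The loss (D/σ)^(2/p) is rounded up to (D/σ)^m, as D/σ ≥ 1. Against the kernel's D^(-(m+2))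
    -- this leaves the integrable factor D^(-2).
    have hFs : ‖F (s * z)‖ ≤
        72 ^ (1 / p) * (σ / δ) ^ (β / 2) * (D / σ) ^ m * U ^ (1 / p) := by
      have h1 := Real.rpow_le_rpow (by positivity) hloc (by positivity : 0 ≤ 1 / p)
      rw [← Real.rpow_mul (norm_nonneg _), mul_one_div_cancel hp.ne', Real.rpow_one,
        Real.mul_rpow (by positivity) hU, Real.mul_rpow (by positivity) (by positivity),
        Real.mul_rpow (by positivity) (by positivity), ← Real.rpow_mul (by positivity),
        ← Real.rpow_natCast (D / σ), ← Real.rpow_mul (by positivity),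
        show β / 2 * p * (1 / p) = β / 2 by field_simp] at h1
      refine h1.trans ?_
      gcongr
      rw [← Real.rpow_natCast (D / σ)]
      refine Real.rpow_le_rpow_of_exponent_le hDσ ?_
      push_cast
      rwa [mul_one_div]
    calc _ ≤ 72 ^ (1 / p) * (σ / δ) ^ (β / 2) * (D / σ) ^ m * U ^ (1 / p) *
          (C₂ / (σ * tail μ s * D ^ (m + 2))) := by gcongr
      _ = _ := by rw [hA, div_pow, pow_add D, pow_succ σ]; field_simp
  have hFs : ContinuousOn (fun z : ℂ => F (s * z)) (sphere 0 1) :=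
    hFc.comp (by fun_prop) fun z hz => by
      have hz1 : ‖z‖ = 1 := by simpa using hz
      simp [hz1, abs_of_nonneg hs0, hs1.le]
  have hinv : ContinuousOn (fun z : ℂ => A * (‖z - s * w‖ ^ 2)⁻¹) (sphere 0 1) := by
    refine continuousOn_const.mul (ContinuousOn.inv₀ (by fun_prop) fun z hz => ?_)
    have := hσ.trans_le (one_sub_le_norm_sub (by simpa using hz : ‖z‖ = 1) hw hs0)
    positivity
  have hmain : ‖Real.circleAverage (fun z => F (s * z) *
      ∑' n, (kernelCoeff μ (m + 2) n : ℂ) * (s * w * z⁻¹) ^ n) 0 1‖ ≤ A * (C₃ / σ) := by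
    have h1 : ‖Real.circleAverage (fun z => F (s * z) *
        ∑' n, (kernelCoeff μ (m + 2) n : ℂ) * (s * w * z⁻¹) ^ n) 0 1‖ ≤
        Real.circleAverage (fun z : ℂ => A * (‖z - s * w‖ ^ 2)⁻¹) 0 1 := by
      rw [Real.circleAverage, Real.circleAverage, norm_smul, smul_eq_mul,
        Real.norm_of_nonneg (by positivity)]
      gcongr
      refine intervalIntegral.norm_integral_le_of_norm_le Real.two_pi_pos.le
        (.of_forall fun θ _ => ?_) (circleIntegrable_of_continuousOn hinv)
      rw [norm_mul]
      exact hpt _ (by simp)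
    refine h1.trans ?_
    rw [circleAverage_const_mul]
    gcongr
    exact hsq w s hw hs0 hs1
  refine hmain.trans ?_
  have htail : (tail μ s)⁻¹ ≤ C₀ * C₁ * (tail μ t)⁻¹ * (δ / (1 - y)) ^ β := by
    have h1 := hhat s hs0 hs1
    rw [hsy] at h1
    have h2 := hcheck y t hy0 hyt ht
    have h3 : tail μ t * ((1 - y) / δ) ^ β ≤ C₀ * C₁ * tail μ s := by
      calc _ ≤ _ := h2
        _ ≤ C₁ * (C₀ * tail μ s) := by gcongr
        _ = _ := by ring
    have h4 : (δ / (1 - y)) ^ β = (((1 - y) / δ) ^ β)⁻¹ := by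
      rw [← Real.inv_rpow (by positivity), inv_div]
    rw [h4, inv_eq_one_div, div_le_iff₀ hts]
    have h5 : 0 < ((1 - y) / δ) ^ β := by positivity
    calc (1 : ℝ) = tail μ t * ((1 - y) / δ) ^ β * ((tail μ t)⁻¹ * (((1 - y) / δ) ^ β)⁻¹) := by
          field_simp
      _ ≤ C₀ * C₁ * tail μ s * ((tail μ t)⁻¹ * (((1 - y) / δ) ^ β)⁻¹) := by gcongr
      _ = _ := by ring
  have hσδ : (σ / δ) ^ (β / 2) * (δ / (1 - y)) ^ β ≤ (δ / (1 - y)) ^ (β / 2) := by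
    have h1 : (δ / (1 - y)) ^ β = (δ / (1 - y)) ^ (β / 2) * (δ / (1 - y)) ^ (β / 2) := by
      rw [← Real.rpow_add (by positivity)]; congr 1; ring
    rw [h1, ← mul_assoc, ← Real.mul_rpow (by positivity) (by positivity)]
    refine mul_le_of_le_one_left (by positivity) (Real.rpow_le_one (by positivity) ?_
      (by positivity))
    rw [div_mul_div_cancel₀ hδ.ne']
    exact div_le_one_of_le₀ hσy h1y.le
  have hσpow : (σ ^ (m + 2))⁻¹ ≤ 2 ^ (m + 2) * ((1 - y) ^ (m + 2))⁻¹ := by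
    rw [← inv_pow, ← inv_pow, ← mul_pow]
    gcongr
    rw [inv_le_comm₀ hσ (by positivity), mul_inv, inv_inv]
    linarith
  calc A * (C₃ / σ) = 72 ^ (1 / p) * C₂ * C₃ * U ^ (1 / p) *
        ((σ / δ) ^ (β / 2) * (tail μ s)⁻¹ * (σ ^ (m + 2))⁻¹) := by
        rw [hA, pow_succ σ (m + 1)]; field_simp
    _ ≤ 72 ^ (1 / p) * C₂ * C₃ * U ^ (1 / p) *
        ((σ / δ) ^ (β / 2) * (C₀ * C₁ * (tail μ t)⁻¹ * (δ / (1 - y)) ^ β) *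
          (2 ^ (m + 2) * ((1 - y) ^ (m + 2))⁻¹)) := by gcongr
    _ = 72 ^ (1 / p) * C₂ * C₃ * U ^ (1 / p) * (C₀ * C₁ * (tail μ t)⁻¹) *
          (2 ^ (m + 2) * ((1 - y) ^ (m + 2))⁻¹) *
        ((σ / δ) ^ (β / 2) * (δ / (1 - y)) ^ β) := by ring
    _ ≤ 72 ^ (1 / p) * C₂ * C₃ * U ^ (1 / p) * (C₀ * C₁ * (tail μ t)⁻¹) *
          (2 ^ (m + 2) * ((1 - y) ^ (m + 2))⁻¹) * (δ / (1 - y)) ^ (β / 2) := by gcongr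
    _ = _ := by ring

/-- `D^μ F` is controlled pointwise by local averages of `F` over the unit circle. -/
lemma IsD.norm_tsum_inv_moment_le {μ : ℝ → ℝ} (hμ : IsD μ) {p : ℝ} (hp : 0 < p) :
    ∃ C ε : ℝ, 0 < C ∧ 0 < ε ∧ ∀ (F : ℂ → ℂ) (φ : ℕ → ℂ) (B : ℝ),
      DiffContOnCl ℂ F (ball 0 1) → (∀ z : ℂ, ‖z‖ < 1 → HasSum (fun n => φ n * z ^ n) (F z)) →
      (∀ n, ‖φ n‖ ≤ B) → ∀ t : ℝ, 0 ≤ t → t < 1 → ∀ w : ℂ, ‖w‖ = 1 →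
      ‖∑' n, (((diffMoment μ 0 n)⁻¹ : ℝ) : ℂ) * φ n * (t * w) ^ n‖ ≤
        C * (locAverage ε (1 - t) p F w ^ (1 / p) / tail μ t) := by
  obtain ⟨m, hm⟩ := exists_nat_ge (2 / p)
  obtain ⟨C, κ, hC, hκ, -, h⟩ := hμ.norm_tsum_kernelCoeff_le hp hm
  refine ⟨C * (2 ^ (1 + κ) * (1 / (1 * κ))), κ * p, by positivity, by positivity,
    fun F φ B hF hsum hφ t ht0 ht w hw => ?_⟩
  set δ := 1 - t with hδdef
  have hδ : 0 < δ := by linarith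
  have htt : 0 < tail μ t := hμ.1.1.tail_pos t ⟨ht0, ht⟩
  have hU := locAverage_nonneg (ε := κ * p) hδ p F w
  set V := locAverage (κ * p) δ p F w ^ (1 / p) / tail μ t
  have hV : 0 ≤ V := by positivity
  -- The power m+1 of 1-x is the one matching kernel coefficients of order m+2.
  have hrep := factorial_mul_tsum_eq hμ.1 (m + 1) hφ ht0 ht hw
  set G := ∑' n, (((diffMoment μ 0 n)⁻¹ : ℝ) : ℂ) * φ n * (t * w) ^ n
  have hG : ‖G‖ ≤ ‖((m + 1).factorial : ℂ) * G‖ := by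
    rw [norm_mul, Complex.norm_natCast]
    exact le_mul_of_one_le_left (norm_nonneg _) (by exact_mod_cast (m + 1).factorial_pos)
  refine hG.trans ?_
  rw [hrep]
  -- The x-integrand will be dominated by this kernel at 1-x, whose integral is bounded
  -- independently of δ.
  set g : ℝ → ℝ := fun x => locKernel κ δ (1 * x) with hg
  have hgc : ContinuousOn g (Icc 0 1) :=
    (continuousOn_locKernel hδ one_pos).mono Icc_subset_Ici_self
  have hgc' : ContinuousOn (fun x => g (1 - x)) (Icc 0 1) :=
    hgc.comp (by fun_prop) fun x hx => ⟨by linarith [hx.2], by linarith [hx.1]⟩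
  have hgi : IntervalIntegrable (fun x => C * V * 2 ^ (1 + κ) * g (1 - x)) volume 0 1 :=
    ContinuousOn.intervalIntegrable_of_Icc zero_le_one (continuousOn_const.mul hgc')
  refine (intervalIntegral.norm_integral_le_of_norm_le zero_le_one
    (.of_forall fun x hx => ?_) hgi).trans ?_
  · have hx0 : 0 ≤ x := hx.1.le
    have hx1 : x ≤ 1 := hx.2
    have h1x : 0 ≤ 1 - x := by linarith
    have hyt : t * x ≤ t := mul_le_of_le_one_right ht0 hx1
    have hyx : t * x ≤ x := mul_le_of_le_one_left hx0 ht.le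
    have h1y : 0 < 1 - t * x := by linarith
    have hn : ‖(1 - x : ℂ)‖ = 1 - x := by
      rw [show (1 - x : ℂ) = ((1 - x : ℝ) : ℂ) by push_cast; ring, Complex.norm_real,
        Real.norm_of_nonneg h1x]
    rw [norm_mul, norm_pow, hn]
    -- Both 1-t and 1-x are at most 1-tx.
    have hloc : δ ^ κ / (1 - t * x) ^ (1 + κ) ≤ 2 ^ (1 + κ) * g (1 - x) := by
      rw [hg]
      simp only [one_mul, locKernel]
      rw [← mul_div_assoc, div_le_div_iff₀ (by positivity) (by positivity)]
      have h1 : (δ + (1 - x)) ^ (1 + κ) ≤ 2 ^ (1 + κ) * (1 - t * x) ^ (1 + κ) := by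
        rw [← Real.mul_rpow zero_le_two h1y.le]
        gcongr
        linarith
      calc _ ≤ δ ^ κ * (2 ^ (1 + κ) * (1 - t * x) ^ (1 + κ)) := by gcongr
        _ = _ := by ring
    have hpow : (1 - t * x) ^ (m + 1) * ((δ / (1 - t * x)) ^ κ / (1 - t * x) ^ (m + 2)) =
        δ ^ κ / (1 - t * x) ^ (1 + κ) := by
      rw [Real.rpow_add h1y, Real.rpow_one, Real.div_rpow hδ.le h1y.le, pow_succ _ (m + 1)]
      field_simp
    calc _ ≤ (1 - t * x) ^ (m + 1) *
          (C * V * ((δ / (1 - t * x)) ^ κ / (1 - t * x) ^ (m + 2))) := by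
          gcongr
          exact h F φ B hF hsum hφ t x ht0 ht hx0 hx1 w hw
      _ = C * V * ((1 - t * x) ^ (m + 1) *
          ((δ / (1 - t * x)) ^ κ / (1 - t * x) ^ (m + 2))) := by ring
      _ ≤ C * V * (2 ^ (1 + κ) * g (1 - x)) := by
          rw [hpow]
          gcongr
      _ = _ := by ring
  · rw [intervalIntegral.integral_const_mul, intervalIntegral.integral_comp_sub_left g, sub_self,
      sub_zero]
    have := integral_locKernel_le hκ hδ one_pos zero_le_one
    calc _ ≤ C * V * 2 ^ (1 + κ) * (1 / (1 * κ)) := by gcongr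
      _ = _ := by ring

/-! ### Averaging the local averages -/

lemma continuous_locKernel_mul {ε δ p : ℝ} (hδ : 0 < δ) (hp : 0 < p) {F : ℂ → ℂ}
    (hF : ContinuousOn F (sphere 0 1)) :
    Continuous (Function.uncurry fun θ α : ℝ =>
      locKernel ε δ ‖circleMap 0 1 α - circleMap 0 1 θ‖ * ‖F (circleMap 0 1 α)‖ ^ p) := by
  have h1 : Continuous fun α : ℝ => ‖F (circleMap 0 1 α)‖ ^ p :=
    ((hF.comp_continuous (continuous_circleMap 0 1)
      (circleMap_mem_sphere _ zero_le_one)).norm).rpow_const fun _ => .inr hp.le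
  have h2 : Continuous fun q : ℝ × ℝ => locKernel ε δ ‖circleMap 0 1 q.2 - circleMap 0 1 q.1‖ :=
    continuous_locKernel_norm_sub hδ (by fun_prop) (by fun_prop)
  exact h2.mul (h1.comp continuous_snd)

lemma continuous_circleAverage {h : ℝ → ℂ → ℝ}
    (hh : Continuous (Function.uncurry fun θ α : ℝ => h θ (circleMap 0 1 α))) :
    Continuous fun θ => Real.circleAverage (h θ) 0 1 := by
  simp only [Real.circleAverage_def, smul_eq_mul]
  exact continuous_const.mul
    (intervalIntegral.continuous_parametric_intervalIntegral_of_continuous' hh 0 (2 * Real.pi))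

lemma circleIntegrable_locAverage {ε δ p : ℝ} (hδ : 0 < δ) (hp : 0 < p) {F : ℂ → ℂ}
    (hF : ContinuousOn F (sphere 0 1)) : CircleIntegrable (locAverage ε δ p F) 0 1 := by
  have h : Continuous fun θ : ℝ => locAverage ε δ p F (circleMap 0 1 θ) :=
    continuous_circleAverage (continuous_locKernel_mul hδ hp hF)
  exact h.intervalIntegrable _ _

/-- Fubini, with the symmetry of the kernel in its centre and its variable. -/
lemma circleAverage_locAverage {ε δ p : ℝ} (hδ : 0 < δ) (hp : 0 < p) {F : ℂ → ℂ}
    (hF : ContinuousOn F (sphere 0 1)) :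
    Real.circleAverage (locAverage ε δ p F) 0 1 = Real.circleAverage
      (fun η => ‖F η‖ ^ p * Real.circleAverage (fun w => locKernel ε δ ‖w - η‖) 0 1) 0 1 := by
  have hcont := continuous_locKernel_mul (ε := ε) hδ hp hF
  have hswap := intervalIntegral_intervalIntegral_swap (a := 0) (b := 2 * Real.pi) (c := 0)
    (d := 2 * Real.pi) (F := fun θ α : ℝ =>
      locKernel ε δ ‖circleMap 0 1 α - circleMap 0 1 θ‖ * ‖F (circleMap 0 1 α)‖ ^ p)
    ((hcont.continuousOn.integrableOn_compact
      (isCompact_uIcc.prod isCompact_uIcc)).mono_set (prod_mono uIoc_subset_uIcc uIoc_subset_uIcc))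
  simp only [locAverage, Real.circleAverage, smul_eq_mul, intervalIntegral.integral_const_mul]
  rw [hswap, ← intervalIntegral.integral_const_mul]
  congr 1
  refine intervalIntegral.integral_congr fun α _ => ?_
  simp only [intervalIntegral.integral_mul_const]
  rw [intervalIntegral.integral_congr (g := fun θ : ℝ =>
    locKernel ε δ ‖circleMap 0 1 θ - circleMap 0 1 α‖) fun θ _ => by
      simp only [norm_sub_rev (circleMap 0 1 α)]]
  ring

lemma circleIntegrable_mul_circleAverage {ε δ p : ℝ} (hδ : 0 < δ) (hp : 0 < p) {F : ℂ → ℂ}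
    (hF : ContinuousOn F (sphere 0 1)) : CircleIntegrable (fun η => ‖F η‖ ^ p *
      Real.circleAverage (fun w => locKernel ε δ ‖w - η‖) 0 1) 0 1 := by
  have h0 : Continuous fun q : ℝ × ℝ => locKernel ε δ ‖circleMap 0 1 q.2 - circleMap 0 1 q.1‖ :=
    continuous_locKernel_norm_sub hδ (by fun_prop) (by fun_prop)
  have h1 : Continuous fun α : ℝ => ‖F (circleMap 0 1 α)‖ ^ p :=
    ((hF.comp_continuous (continuous_circleMap 0 1)
      (circleMap_mem_sphere _ zero_le_one)).norm).rpow_const fun _ => .inr hp.le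
  have h2 : Continuous fun α : ℝ => Real.circleAverage
      (fun w => locKernel ε δ ‖w - circleMap 0 1 α‖) 0 1 :=
    continuous_circleAverage (h := fun α w => locKernel ε δ ‖w - circleMap 0 1 α‖) h0
  exact (h1.mul h2).intervalIntegrable _ _

lemma circleAverage_locAverage_le {ε : ℝ} (hε : 0 < ε) {p : ℝ} (hp : 0 < p) :
    ∃ C : ℝ, 0 < C ∧ ∀ δ : ℝ, 0 < δ → ∀ F : ℂ → ℂ, ContinuousOn F (sphere 0 1) →
      Real.circleAverage (locAverage ε δ p F) 0 1 ≤
        C * Real.circleAverage (fun z => ‖F z‖ ^ p) 0 1 := by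
  obtain ⟨C, hC, hker⟩ := circleAverage_locKernel_le hε
  refine ⟨C, hC, fun δ hδ F hF => ?_⟩
  have hFi : CircleIntegrable (fun z => C * ‖F z‖ ^ p) 0 1 :=
    circleIntegrable_of_continuousOn
      (continuousOn_const.mul (hF.norm.rpow_const fun _ _ => .inr hp.le))
  rw [circleAverage_locAverage hδ hp hF, ← circleAverage_const_mul]
  refine Real.circleAverage_mono (circleIntegrable_mul_circleAverage hδ hp hF) hFi fun η hη => ?_
  rw [mul_comm]
  exact mul_le_mul_of_nonneg_right (hker δ hδ η (by simpa using hη)) (by positivity)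

/-! ### Convergence of the series and the integral means -/

lemma norm_taylorCoeff_mul_pow_le {f : ℂ → ℂ} (hf : DifferentiableOn ℂ f (ball 0 1)) {R : ℝ}
    (hR0 : 0 ≤ R) (hR : R < 1) : ∃ B : ℝ, ∀ n, ‖taylorCoeff f n‖ * R ^ n ≤ B := by
  have h := (Complex.hasSum_taylorSeries_on_ball hf (z := (R : ℂ))
    (by simpa [abs_of_nonneg hR0] using hR)).summable.tendsto_atTop_zero
  obtain ⟨B, hB⟩ := (Metric.isBounded_range_of_tendsto _ h).exists_norm_le
  refine ⟨B, fun n => ?_⟩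
  have := hB _ ⟨n, rfl⟩
  refine le_trans (le_of_eq ?_) this
  simp only [taylorCoeff, sub_zero, smul_eq_mul, norm_mul, norm_inv, norm_div, norm_pow,
    Complex.norm_real, Real.norm_of_nonneg hR0]
  ring

lemma norm_fracDerivTerm_le {μ : ℝ → ℝ} {f : ℂ → ℂ} {R B : ℝ} (hR0 : 0 < R)
    (hB : ∀ n, ‖taylorCoeff f n‖ * R ^ n ≤ B) {R' : ℝ} {z : ℂ} (hz : ‖z‖ ≤ R') (n : ℕ) :
    ‖fracDerivTerm μ f z n‖ ≤ B * (|(diffMoment μ 0 n)⁻¹| * (R' / R) ^ n) := by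
  have hR' : 0 ≤ R' := (norm_nonneg z).trans hz
  rw [fracDerivTerm, moment_odd, norm_mul, norm_div, norm_pow, Complex.norm_real,
    Real.norm_eq_abs, abs_inv]
  calc _ ≤ ‖taylorCoeff f n‖ / |diffMoment μ 0 n| * R' ^ n := by gcongr
    _ = (‖taylorCoeff f n‖ * R ^ n) * (|diffMoment μ 0 n|⁻¹ * (R' / R) ^ n) := by
      rw [div_pow]; field_simp
    _ ≤ _ := by gcongr; exact hB n

/-- Cauchy-type bounds at an intermediate radius R leave the geometric factor (R'/R)^n, which beats
the polynomial growth of 1/μ_{2n+1}. -/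
lemma IsDHat.summable_fracDerivTerm {μ : ℝ → ℝ} (hμ : IsDHat μ) {f : ℂ → ℂ}
    (hf : DifferentiableOn ℂ f (ball 0 1)) {R' : ℝ} (hR0 : 0 ≤ R') (hR : R' < 1) :
    ∃ u : ℕ → ℝ, Summable u ∧ ∀ z : ℂ, ‖z‖ ≤ R' → ∀ n, ‖fracDerivTerm μ f z n‖ ≤ u n := by
  obtain ⟨R, h1, h2⟩ := exists_between hR
  have hR0' : 0 < R := hR0.trans_lt h1
  obtain ⟨B, hB⟩ := norm_taylorCoeff_mul_pow_le hf hR0'.le h2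
  exact ⟨_, (hμ.polyBdd_inv_moment.summable (by positivity) ((div_lt_one hR0').2 h1)).mul_left B,
    fun z hz n => norm_fracDerivTerm_le hR0' hB hz n⟩

lemma IsDHat.differentiableOn_fracDeriv {μ : ℝ → ℝ} (hμ : IsDHat μ) {f : ℂ → ℂ}
    (hf : DifferentiableOn ℂ f (ball 0 1)) : DifferentiableOn ℂ (fracDeriv μ f) (ball 0 1) := by
  intro z hz
  rw [mem_ball_zero_iff] at hz
  obtain ⟨R, h1, h2⟩ := exists_between hz
  obtain ⟨u, hu, h⟩ := hμ.summable_fracDerivTerm hf ((norm_nonneg z).trans h1.le) h2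
  have hd : DifferentiableOn ℂ (fun z => ∑' n, fracDerivTerm μ f z n) (ball 0 R) :=
    Complex.differentiableOn_tsum_of_summable_norm hu (fun n => by unfold fracDerivTerm; fun_prop)
      isOpen_ball fun n z hz => h z (mem_ball_zero_iff.1 hz).le n
  exact (hd.differentiableAt (isOpen_ball.mem_nhds (mem_ball_zero_iff.2 h1))).differentiableWithinAt

lemma IsD.integralMean_fracDeriv_le {μ : ℝ → ℝ} (hμ : IsD μ) {p : ℝ} (hp : 0 < p) :
    ∃ C : ℝ, 0 < C ∧ ∀ f : ℂ → ℂ, DifferentiableOn ℂ f (ball 0 1) →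
      ∀ r ρ : ℝ, 0 ≤ r → r < ρ → ρ < 1 →
        integralMean p r (fracDeriv μ f) ≤ C * (integralMean p ρ f / tail μ (r / ρ)) := by
  obtain ⟨C₁, ε, hC₁, hε, hpoint⟩ := hμ.norm_tsum_inv_moment_le hp
  obtain ⟨C₂, hC₂, havg⟩ := circleAverage_locAverage_le hε hp
  refine ⟨C₁ * C₂ ^ (1 / p), by positivity, fun f hf r ρ hr0 hr hρ => ?_⟩
  have hρ0 : 0 < ρ := hr0.trans_lt hr
  set t := r / ρ with htdef
  have ht0 : 0 ≤ t := by positivity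
  have ht : t < 1 := (div_lt_one hρ0).2 hr
  have hrt : r = t * ρ := by rw [htdef]; field_simp
  have htt : 0 < tail μ t := hμ.1.1.tail_pos t ⟨ht0, ht⟩
  set F : ℂ → ℂ := fun z => f (ρ * z) with hFdef
  have hnorm {z : ℂ} : ‖(ρ : ℂ) * z‖ = ρ * ‖z‖ := by simp [abs_of_pos hρ0]
  have hFd : DifferentiableOn ℂ F (closedBall 0 1) :=
    hf.comp (by fun_prop) fun z hz => by
      rw [mem_closedBall_zero_iff] at hz
      rw [mem_ball_zero_iff, hnorm]
      nlinarith
  have hFcl : DiffContOnCl ℂ F (ball 0 1) :=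
    DifferentiableOn.diffContOnCl (by rwa [closure_ball _ one_ne_zero])
  have hFs : ContinuousOn F (sphere 0 1) := hFd.continuousOn.mono sphere_subset_closedBall
  set φ : ℕ → ℂ := fun n => taylorCoeff f n * (ρ : ℂ) ^ n with hφdef
  have hsum (z : ℂ) (hz : ‖z‖ < 1) : HasSum (fun n => φ n * z ^ n) (F z) := by
    have h := Complex.hasSum_taylorSeries_on_ball hf (z := (ρ : ℂ) * z)
      (by rw [mem_ball_zero_iff, hnorm]; nlinarith)
    refine (congrArg (fun g => HasSum g _) (funext fun n => ?_)).mp h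
    simp only [hφdef, taylorCoeff, smul_eq_mul, sub_zero]
    ring
  obtain ⟨B, hB⟩ := norm_taylorCoeff_mul_pow_le hf hρ0.le hρ
  have hφ (n : ℕ) : ‖φ n‖ ≤ B := by
    simpa [hφdef, abs_of_pos hρ0] using hB n
  have hG (w : ℂ) : fracDeriv μ f (r * w + 0) =
      ∑' n, (((diffMoment μ 0 n)⁻¹ : ℝ) : ℂ) * φ n * (t * w) ^ n := by
    unfold fracDeriv
    congr 1
    ext n
    rw [fracDerivTerm, moment_odd, hrt, hφdef]
    push_cast
    ring
  have hmean : integralMean p ρ f = Real.circleAverage (fun z => ‖F z‖ ^ p) 0 1 ^ (1 / p) := by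
    rw [integralMean, Real.circleAverage_eq_circleAverage_zero_one]
    simp [hFdef]
  have hFp0 : 0 ≤ Real.circleAverage (fun z => ‖F z‖ ^ p) 0 1 :=
    Real.circleAverage_nonneg_of_nonneg fun z _ => by positivity
  have hδ : 0 < 1 - t := by linarith
  -- Raising to the power p cancels the exponent 1/p, so the local average enters linearly and can
  -- be averaged in w for every p > 0.
  have hpow (w : ℂ) (hw : ‖w‖ = 1) : ‖fracDeriv μ f (r * w + 0)‖ ^ p ≤
      (C₁ / tail μ t) ^ p * locAverage ε (1 - t) p F w := by
    have hU := locAverage_nonneg (ε := ε) hδ p F w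
    rw [hG]
    refine (Real.rpow_le_rpow (norm_nonneg _)
      (hpoint F φ B hFcl hsum hφ t ht0 ht w hw) hp.le).trans (le_of_eq ?_)
    rw [← mul_div_assoc, mul_div_right_comm, Real.mul_rpow (by positivity) (by positivity),
      ← Real.rpow_mul hU, one_div_mul_cancel hp.ne', Real.rpow_one]
  have hDc : ContinuousOn (fun w : ℂ => ‖fracDeriv μ f (r * w + 0)‖ ^ p) (sphere 0 1) := by
    refine ContinuousOn.rpow_const (ContinuousOn.norm
      ((hμ.1.differentiableOn_fracDeriv hf).continuousOn.comp (by fun_prop) fun w hw => ?_))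
      fun _ _ => .inr hp.le
    have hw1 : ‖w‖ = 1 := by simpa using hw
    simp only [add_zero, mem_ball_zero_iff, norm_mul, hw1, mul_one, Complex.norm_real,
      Real.norm_of_nonneg hr0]
    linarith
  have hmain : Real.circleAverage (fun z => ‖fracDeriv μ f z‖ ^ p) 0 r ≤
      (C₁ / tail μ t) ^ p * (C₂ * Real.circleAverage (fun z => ‖F z‖ ^ p) 0 1) := by
    have hi : CircleIntegrable (fun w => (C₁ / tail μ t) ^ p * locAverage ε (1 - t) p F w) 0 1 :=
      IntervalIntegrable.const_mul (circleIntegrable_locAverage hδ hp hFs) _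
    rw [Real.circleAverage_eq_circleAverage_zero_one]
    refine (Real.circleAverage_mono (circleIntegrable_of_continuousOn hDc) hi
      fun w hw => hpow w (by simpa using hw)).trans ?_
    rw [circleAverage_const_mul]
    gcongr
    exact havg _ hδ F hFs
  have h0 : 0 ≤ Real.circleAverage (fun z => ‖fracDeriv μ f z‖ ^ p) 0 r :=
    Real.circleAverage_nonneg_of_nonneg fun z _ => by positivity
  rw [hmean, integralMean]
  refine (Real.rpow_le_rpow h0 hmain (by positivity)).trans (le_of_eq ?_)
  rw [Real.mul_rpow (by positivity) (by positivity), Real.mul_rpow hC₂.le hFp0,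
    ← Real.rpow_mul (by positivity), mul_one_div_cancel hp.ne', Real.rpow_one]
  ring

end FracDeriv

theorem mainTheorem3 (p : ℝ) (hp : 0 < p) (μ : ℝ → ℝ) (hμ : FracDeriv.IsD μ) :
    (∀ f : ℂ → ℂ, DifferentiableOn ℂ f (Metric.ball 0 1) →
      (∀ z ∈ Metric.ball (0 : ℂ) 1, Summable (FracDeriv.fracDerivTerm μ f z)) ∧
        DifferentiableOn ℂ (FracDeriv.fracDeriv μ f) (Metric.ball 0 1)) ∧
    ∃ C : ℝ, 0 < C ∧ ∀ f : ℂ → ℂ, DifferentiableOn ℂ f (Metric.ball 0 1) →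
      ∀ r ρ : ℝ, 0 ≤ r → r < ρ → ρ < 1 →
        FracDeriv.integralMean p r (FracDeriv.fracDeriv μ f) ≤
          C * (FracDeriv.integralMean p ρ f / FracDeriv.tail μ (r / ρ)) := by
  refine ⟨fun f hf => ⟨fun z hz => ?_, hμ.1.differentiableOn_fracDeriv hf⟩,
    hμ.integralMean_fracDeriv_le hp⟩
  obtain ⟨u, hu, h⟩ := hμ.1.summable_fracDerivTerm hf (norm_nonneg z) (mem_ball_zero_iff.1 hz)
  exact .of_norm_bounded hu (h z le_rfl)
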